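/- **Setting.** Let $(\tilde X,\tilde Y)\in\mathbb R^d\times\mathbb R$ with $\mathbb E\|\tilde X\|^2<\infty$, $G=\mathbb E(\tilde X\tilde X^\top)$ of full rank $d$, and $\tilde Y=\langle\theta_*,\tilde X\rangle+\eta$, where $\eta\sim\mathcal N(0,\sigma^2)$, $\sigma>0$, is independent of $\tilde X$. Let $\epsilon\in(0,1/2)$. For $p\in(0,1]$ let $\xi$ be a Bernoulli variable of parameter $p$ independent of $(\tilde X,\tilde Y)$ and let $(X,Y)=(\xi\tilde X,\xi\tilde Y)$. Put $\tilde R(\theta)=\mathbb E[(\tilde Y-\langle\theta,\tilde X\rangle)^2]$ and $R(\theta)=\mathbb E[(Y-\langle\theta,X\rangle)^2]$. Define in $[0,\infty]$ $$\kappa_1=\sup\{\mathbb E\langle\theta,X\rangle^4:\theta\in\mathbb R^d,\ \mathbb E\langle\theta,X\rangle^2\le1\},\qquad \kappa_2=\frac{\mathbb E[(Y-\langle\theta_*,X\rangle)^4]}{\mathbb E[(Y-\langle\theta_*,X\rangle)^2]^2},$$ and define $\tilde\kappa_1,\tilde\kappa_2$ in the same way from $(\tilde X,\tilde Y)$. An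 empirical risk minimizer (ERM) of a sample $(x_i,y_i)_{i\le n}$ of size $n\ge1$ is any minimizer of $\theta\mapsto\sum_{i=1}^n(y_i-\langle\theta,x_i\rangle)^2$. Samples consist of $n$ independent copies $(\tilde X_i,\tilde Y_i)$ of $(\tilde X,\tilde Y)$, or $(X_i,Y_i)$ of $(X,Y)$. The bounds below on ERMs hold on one event simultaneously for all ERMs $\tilde\theta$ (uncensored sample) or $\hat\theta$ (censored sample). **Kurtosis coefficients.** $\theta_*$ minimizes $\tilde R$ and $R$; $\tilde\kappa_2=3$; $\kappa_1=\tilde\kappa_1/p$ and $\kappa_2=\tilde\kappa_2/p$, so that $p^{-1}=(\kappa_1+\kappa_2)/(\tilde\kappa_1+\tilde\kappa_2)$ if $\tilde\kappa_1<\infty$; and $\kappa_1+\kappa_2$ can be made arbitrarily large by the choice of $p\in(0,1]$. **Lower bounds.** Assume that for some $\delta\in(0,1)$ and $n_\epsilon\in\mathbb N$, for every $n\ge n_\epsilon$, with probability at least $1-2\epsilon$, for all $\theta\in\mathbb R^d$, $$\left|\frac{\frac1n\sum_{i=1}^n\langle\theta,\tilde X_i\rangle^2}{\mathbb E\langle\theta,\tilde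 X\rangle^2}-1\right|\le\delta\qquad(0/0=1,\ z/0=\infty\text{ for }z>0).\tag{1}$$ (a) For every $n\ge n_\epsilon$, with probability at least $1-3\epsilon$, $$\tilde R(\tilde\theta)-\tilde R(\theta_*)\ \ge\ \frac{[d\log2-2\log\epsilon^{-1}]\,\sigma^2}{(1+\delta)\,n}.$$ (b) If $\tilde\kappa_1<\infty$, then for every $p\in(0,1]$ and every $n\ge\dfrac{4(\kappa_1+\kappa_2)\max\{n_\epsilon,2\log\epsilon^{-1}\}}{\tilde\kappa_1+\tilde\kappa_2}$, with probability at least $1-5\epsilon$, $$R(\hat\theta)-R(\theta_*)\ \ge\ \frac{4[d\log2-2\log\epsilon^{-1}](\kappa_1+\kappa_2)}{7(1+\delta)(\tilde\kappa_1+\tilde\kappa_2)\,n}\,R(\theta_*).$$ (c) Consequently the dependence on $\kappa_1+\kappa_2$ of the first order term of an upper bound cannot be improved: if $\tilde\kappa_1<\infty$, $p\in(0,1]$, $\epsilon'\ge0$, $5\epsilon+\epsilon'<1$, and if for some choice $\hat\theta_n$ of an ERM of the censored sample and some reals $U_n$ with $nU_n\to A$ one has, for all large $n$, $R(\hat\theta_n)-R(\theta_*)\le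 U_nR(\theta_*)$ with probability at least $1-\epsilon'$, then $$A\ \ge\ \frac{4[d\log2-2\log\epsilon^{-1}](\kappa_1+\kappa_2)}{7(1+\delta)(\tilde\kappa_1+\tilde\kappa_2)}.$$ **Gaussian design.** Assume, instead of (1), that $\tilde X$ is a Gaussian vector, centred or not. If $d\ge2$, or if $d=1$ and $\tilde X$ is centred, then $\tilde\kappa_1+\tilde\kappa_2=6$. Put $$n_\epsilon=8.4\,[0.73\,d+\log\epsilon^{-1}]\,[1.4\,d+4\log\epsilon^{-1}+26.3]^2 .$$ For every $n\ge n_\epsilon$, (1) holds with $\delta=8/9$ with probability at least $1-2\epsilon$. For every $p\in(0,1]$ and every $n\ge\frac23(\kappa_1+\kappa_2)n_\epsilon$, with probability at least $1-5\epsilon$, $$R(\hat\theta)-R(\theta_*)\ \ge\ \frac{35}{1000}\cdot\frac{[d-3\log\epsilon^{-1}](\kappa_1+\kappa_2)}{n}\,R(\theta_*).$$ -/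

import Mathlib

open MeasureTheory ProbabilityTheory Filter Topology
open scoped ENNReal NNReal

noncomputable section

/-- `ℝ^d` with its Euclidean structure. -/
abbrev Vec (d : ℕ) : Type := EuclideanSpace ℝ (Fin d)

/-- A value of a couple (design, response) in `ℝ^d × ℝ`. -/
abbrev Pair (d : ℕ) : Type := Vec d × ℝ

/-- "With probability at least `a`, an i.i.d. sample of size `n` from `P` satisfies `Φ`".
The law of a sample of `n` independent copies is the product measure `P^{⊗ n}`.  Some measurable
event of probability at least `a` must be contained in `Φ`, so that no measurability of `Φ` itself
is needed (its inner probability is at least `a`). -/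
def SampleHolds {d : ℕ} (P : Measure (Pair d)) (n : ℕ) (a : ℝ)
    (Φ : (Fin n → Pair d) → Prop) : Prop :=
  ∃ A : Set (Fin n → Pair d), MeasurableSet A ∧
    ENNReal.ofReal a ≤ Measure.pi (fun _ : Fin n => P) A ∧ ∀ z ∈ A, Φ z

/-- The quadratic risk `E[(Y - ⟨θ, X⟩)²]` when `(X, Y)` has law `P`. -/
def risk {d : ℕ} (P : Measure (Pair d)) (θ : Vec d) : ℝ :=
  ∫ z, (z.2 - inner ℝ θ z.1) ^ 2 ∂P

/-- The energy `E⟨θ, X⟩²` when `(X, Y)` has law `P`. -/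
def energy {d : ℕ} (P : Measure (Pair d)) (θ : Vec d) : ℝ :=
  ∫ z, (inner ℝ θ z.1) ^ 2 ∂P

/-- The empirical energy `(1/n) ∑ ⟨θ, X_i⟩²`. -/
def empEnergy {d n : ℕ} (z : Fin n → Pair d) (θ : Vec d) : ℝ :=
  (1 / (n : ℝ)) * ∑ i, (inner ℝ θ (z i).1) ^ 2

/-- `|a / b - 1| ≤ δ` for nonnegative `a`, `b`, with the conventions `0 / 0 = 1` and
`a / 0 = ∞` for `a > 0`. -/
def RelDevLe (a b δ : ℝ) : Prop :=
  if b = 0 then a = 0 else |a / b - 1| ≤ δ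

/-- The relative deviation of the empirical Gram matrix is at most `δ` in every direction. -/
def GramDevLe {d n : ℕ} (P : Measure (Pair d)) (δ : ℝ) (z : Fin n → Pair d) : Prop :=
  ∀ θ : Vec d, RelDevLe (empEnergy z θ) (energy P θ) δ

/-- `θ ∈ argmin_{θ'} ∑ (Y_i - ⟨θ', X_i⟩)²`: an empirical risk minimizer of the sample `z`. -/
def IsERM {d n : ℕ} (z : Fin n → Pair d) (θ : Vec d) : Prop :=
  ∀ θ' : Vec d,
    ∑ i, ((z i).2 - inner ℝ θ (z i).1) ^ 2 ≤ ∑ i, ((z i).2 - inner ℝ θ' (z i).1) ^ 2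

/-- The Gram matrix `E(X Xᵀ)` when `X` has law `Q`. -/
def gram {d : ℕ} (Q : Measure (Vec d)) : Matrix (Fin d) (Fin d) ℝ :=
  Matrix.of fun i j => ∫ x, x i * x j ∂Q

/-- The law of `(X, ⟨θs, X⟩ + η)` where `X` has law `Q` and `η` is a `N(0, σ²)` noise independent
from `X`. -/
def linearModel {d : ℕ} (Q : Measure (Vec d)) (θs : Vec d) (σ : ℝ) : Measure (Pair d) :=
  (Q.prod (gaussianReal 0 (σ ^ 2).toNNReal)).map (fun w => (w.1, inner ℝ θs w.1 + w.2))

/-- The law of `(ξ X, ξ Y)` where `(X, Y)` has law `P` and `ξ` is a Bernoulli variable of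
parameter `p` (equal to `1` with probability `p`, to `0` otherwise) independent from `(X, Y)`. -/
def censored {d : ℕ} (P : Measure (Pair d)) (p : unitInterval) : Measure (Pair d) :=
  ((bernoulliMeasure (1 : ℝ) 0 p).prod P).map (fun w => (w.1 • w.2.1, w.1 * w.2.2))

/-- The design kurtosis `sup {E⟨θ, X⟩⁴ : E⟨θ, X⟩² ≤ 1}`, with values in `[0, ∞]`. -/
def kappa1 {d : ℕ} (P : Measure (Pair d)) : ℝ≥0∞ :=
  ⨆ (θ : Vec d) (_ : ∫⁻ z, ENNReal.ofReal ((inner ℝ θ z.1) ^ 2) ∂P ≤ 1),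
    ∫⁻ z, ENNReal.ofReal ((inner ℝ θ z.1) ^ 4) ∂P

open Classical in
/-- The noise kurtosis `E[(Y - ⟨θs, X⟩)⁴] / E[(Y - ⟨θs, X⟩)²]²` if the denominator is positive,
and `0` otherwise. -/
def kappa2 {d : ℕ} (P : Measure (Pair d)) (θs : Vec d) : ℝ≥0∞ :=
  if 0 < ∫⁻ z, ENNReal.ofReal ((z.2 - inner ℝ θs z.1) ^ 2) ∂P then
    (∫⁻ z, ENNReal.ofReal ((z.2 - inner ℝ θs z.1) ^ 4) ∂P) /
      (∫⁻ z, ENNReal.ofReal ((z.2 - inner ℝ θs z.1) ^ 2) ∂P) ^ 2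
  else 0

/-- `κ₁ + κ₂` as a real number (only used where it is finite). -/
def kappaSum {d : ℕ} (P : Measure (Pair d)) (θs : Vec d) : ℝ :=
  (kappa1 P + kappa2 P θs).toReal

/-- The explicit sample size threshold for a Gaussian design. -/
def gaussianThreshold (d : ℕ) (ε : ℝ) : ℝ :=
  8.4 * (0.73 * d + Real.log ε⁻¹) * (1.4 * d + 4 * Real.log ε⁻¹ + 26.3) ^ 2

end

/-! ### Product measures and Chernoff bounds -/

/-! Write `empGain` at `u` for the quadratic gain 2 ∑ ηᵢ⟨u, Xᵢ⟩ - ∑ ⟨u, Xᵢ⟩². An ERM θ maximizes it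
at `u = θ - θs`, and by homogeneity the maximal value is the empirical energy ∑ ⟨θ - θs, Xᵢ⟩² of the
error. Given a design that spans ℝ^d, this maximum is the squared norm of the projection of the
noise on a d-dimensional subspace of ℝⁿ, that is, σ² times a chi-square variable with d degrees of
freedom. Chernoff's bound for its lower tail (`gaussian_projection_tail`) shows that it exceeds (d
log 2 - 2 log ε⁻¹) σ² with probability at least 1 - ε. When the Gram deviation is at most δ, the
empirical energy is at most (1 + δ) n times the energy of the error, which is the excess risk. This
gives `excess_risk_lower_bound`.

Censoring multiplies each moment by p, hence both kurtosis coefficients by 1/p. Null observations do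
not enter the empirical risk, and given the number m of the others, these form an uncensored sample
of size m (`SampleHolds.censored`). The excess risk is then at least p times the uncensored bound
for m observations. Since m is at most K n p, the factor p cancels, whereas R(θs) = p σ². Relative
to R(θs) the bound has gained the factor 1/p, which is the ratio of the kurtosis sums. The binomial
tails of m cost 2ε (`binomialMass_ge`), whence the total 5ε.

For a Gaussian design, ⟨θ, X⟩² is sub-exponential in each direction. A union bound over the
directions uᵢ ± uⱼ built on a basis orthonormal for the Gram matrix, followed by polarization,
controls all directions at once. -/

theorem lintegral_pi_prod_eq_pow {α : Type*} [MeasurableSpace α] (μ : Measure α)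
    [IsProbabilityMeasure μ] (n : ℕ) {f : α → ℝ≥0∞} (hf : Measurable f) :
    ∫⁻ z, ∏ i, f (z i) ∂(Measure.pi fun _ : Fin n => μ) = (∫⁻ x, f x ∂μ) ^ n := by
  have hind : iIndepFun (fun (i : Fin n) (z : Fin n → α) => f (z i))
      (Measure.pi fun _ : Fin n => μ) := iIndepFun_pi (fun _ => hf.aemeasurable)
  rw [lintegral_prod_eq_prod_lintegral_of_indepFun Finset.univ _ hind (fun i => by fun_prop)]
  have : ∀ i : Fin n, ∫⁻ z, f (z i) ∂(Measure.pi fun _ : Fin n => μ) = ∫⁻ x, f x ∂μ := fun i =>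
    (measurePreserving_eval (fun _ : Fin n => μ) i).lintegral_comp hf
  simp [this]

/-- Chernoff's bound for a sum of independent copies. -/
theorem measure_pi_le_sum_le {α : Type*} [MeasurableSpace α] (μ : Measure α)
    [IsProbabilityMeasure μ] (n : ℕ) {φ : α → ℝ} (hφ : Measurable φ) (a : ℝ) :
    Measure.pi (fun _ : Fin n => μ) {z | a ≤ ∑ i, φ (z i)} ≤
      ENNReal.ofReal (Real.exp (-a)) * (∫⁻ x, ENNReal.ofReal (Real.exp (φ x)) ∂μ) ^ n := by
  rw [← lintegral_pi_prod_eq_pow μ n (by fun_prop), ← lintegral_const_mul _ (by fun_prop)]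
  have hm : MeasurableSet {z : Fin n → α | a ≤ ∑ i, φ (z i)} :=
    measurableSet_le measurable_const (by fun_prop)
  rw [← lintegral_indicator_one hm]
  refine lintegral_mono fun z => ?_
  by_cases hz : z ∈ {z : Fin n → α | a ≤ ∑ i, φ (z i)}
  · rw [Set.indicator_of_mem hz, ← ENNReal.ofReal_prod_of_nonneg (fun _ _ => (Real.exp_pos _).le),
      ← Real.exp_sum, ← ENNReal.ofReal_mul (Real.exp_pos _).le, ← Real.exp_add]
    simp only [Pi.one_apply, ENNReal.one_le_ofReal, Real.one_le_exp_iff]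
    have : a ≤ ∑ i, φ (z i) := hz
    linarith
  · rw [Set.indicator_of_notMem hz]; exact zero_le

/-- By continuity it suffices to test the inequality on a countable dense set of parameters. This
makes the events quantified over all directions measurable. -/
theorem measurableSet_forall_le_of_continuous {α E : Type*} [MeasurableSpace α]
    [TopologicalSpace E] [TopologicalSpace.SeparableSpace E] [Nonempty E]
    {f g : α → E → ℝ} (hf : ∀ u, Measurable fun z => f z u) (hg : ∀ u, Measurable fun z => g z u)
    (hfc : ∀ z, Continuous (f z)) (hgc : ∀ z, Continuous (g z)) :
    MeasurableSet {z | ∀ u, f z u ≤ g z u} := by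
  have : {z | ∀ u, f z u ≤ g z u} =
      ⋂ k : ℕ, {z | f z (TopologicalSpace.denseSeq E k) ≤ g z (TopologicalSpace.denseSeq E k)} := by
    ext z
    simp only [Set.mem_ofPred_eq, Set.mem_iInter]
    refine ⟨fun h k => h _, fun h u => ?_⟩
    have hcl : IsClosed {u | f z u ≤ g z u} := isClosed_le (hfc z) (hgc z)
    have : closure (Set.range (TopologicalSpace.denseSeq E)) ⊆ {u | f z u ≤ g z u} :=
      hcl.closure_subset_iff.2 (by rintro _ ⟨k, rfl⟩; exact h k)
    exact this ((TopologicalSpace.denseRange_denseSeq E) u)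
  rw [this]
  exact MeasurableSet.iInter fun k => measurableSet_le (hf _) (hg _)

/-! ### Moments of one-dimensional Gaussian laws -/

/-- The fourth moment of a real Gaussian law. -/
theorem integral_pow_four_gaussianReal (m : ℝ) (v : ℝ≥0) :
    ∫ x, x ^ 4 ∂(gaussianReal m v) = m ^ 4 + 6 * m ^ 2 * v + 3 * (v : ℝ) ^ 2 := by
  -- The moment is the fourth derivative at 0 of the moment generating function exp(mt + vt²/2).
  -- Each successive derivative is a polynomial in m + vt times this exponential.
  have h := iteratedDeriv_mgf_zero (X := fun x : ℝ => x) (μ := gaussianReal m v) (by simp) 4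
  simp only [Pi.pow_apply] at h
  rw [← h, mgf_fun_id_gaussianReal]
  set e : ℝ → ℝ := fun t => Real.exp (m * t + v * t ^ 2 / 2)
  have he : ∀ t, HasDerivAt e ((m + v * t) * e t) t := fun t => by
    have : HasDerivAt (fun t : ℝ => m * t + v * t ^ 2 / 2) (m + v * t) t := by
      have := ((hasDerivAt_id t).const_mul m).add
        ((((hasDerivAt_id t).pow 2).const_mul (v : ℝ)).div_const 2)
      refine this.congr_deriv ?_
      simp; ring
    exact this.exp.congr_deriv (by ring)
  have hl : ∀ t, HasDerivAt (fun t : ℝ => m + v * t) v t := fun t => by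
    simpa using ((hasDerivAt_id t).const_mul (v : ℝ)).const_add m
  have h1 : deriv e = fun t => (m + v * t) * e t := funext fun t => (he t).deriv
  have h2 : deriv (fun t => (m + v * t) * e t) = fun t => ((m + v * t) ^ 2 + v) * e t :=
    funext fun t => (((hl t).mul (he t)).congr_deriv (by ring)).deriv
  have h3 : deriv (fun t => ((m + v * t) ^ 2 + v) * e t) =
      fun t => ((m + v * t) ^ 3 + 3 * v * (m + v * t)) * e t :=
    funext fun t => (((((hl t).pow 2).add_const (v : ℝ)).mul (he t)).congr_deriv
      (by simp; ring)).deriv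
  have h4 : deriv (fun t => ((m + v * t) ^ 3 + 3 * v * (m + v * t)) * e t) =
      fun t => ((m + v * t) ^ 4 + 6 * v * (m + v * t) ^ 2 + 3 * v ^ 2) * e t :=
    funext fun t => (((((hl t).pow 3).add ((hl t).const_mul (3 * (v : ℝ)))).mul
      (he t)).congr_deriv (by simp; ring)).deriv
  have e0 : e 0 = 1 := by simp [e]
  simp only [iteratedDeriv_succ, iteratedDeriv_zero]
  rw [h1, h2, h3, h4]
  simp only [e0]
  ring

theorem integral_sq_gaussianReal (m : ℝ) (v : ℝ≥0) :
    ∫ x, x ^ 2 ∂(gaussianReal m v) = m ^ 2 + v := by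
  have h := variance_eq_sub (memLp_id_gaussianReal (μ := m) (v := v) 2)
  rw [variance_id_gaussianReal] at h
  simp only [Pi.pow_apply, id, integral_id_gaussianReal] at h
  linarith

theorem integrable_pow_gaussianReal (m : ℝ) (v : ℝ≥0) (k : ℕ) :
    Integrable (fun x => x ^ k) (gaussianReal m v) := by
  have h := (memLp_id_gaussianReal (μ := m) (v := v) k).integrable_norm_pow'
  refine (integrable_norm_iff (by fun_prop)).1 ?_
  simpa [norm_pow] using h

theorem lintegral_sq_gaussianReal (m : ℝ) (v : ℝ≥0) :
    ∫⁻ x, ENNReal.ofReal (x ^ 2) ∂(gaussianReal m v) = ENNReal.ofReal (m ^ 2 + v) := by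
  rw [← integral_sq_gaussianReal, ofReal_integral_eq_lintegral_ofReal
    (integrable_pow_gaussianReal m v 2) (ae_of_all _ fun x => by positivity)]

theorem lintegral_pow_four_gaussianReal (m : ℝ) (v : ℝ≥0) :
    ∫⁻ x, ENNReal.ofReal (x ^ 4) ∂(gaussianReal m v) =
      ENNReal.ofReal (m ^ 4 + 6 * m ^ 2 * v + 3 * (v : ℝ) ^ 2) := by
  rw [← integral_pow_four_gaussianReal, ofReal_integral_eq_lintegral_ofReal
    (integrable_pow_gaussianReal m v 4) (ae_of_all _ fun x => by positivity)]

/-- The exponential moment of the square of a real Gaussian variable. -/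
theorem lintegral_exp_mul_sq_gaussianReal (m : ℝ) (v : ℝ≥0) {t : ℝ} (ht : 2 * t * v < 1) :
    ∫⁻ x, ENNReal.ofReal (Real.exp (t * x ^ 2)) ∂(gaussianReal m v) =
      ENNReal.ofReal ((√(1 - 2 * t * v))⁻¹ * Real.exp (t * m ^ 2 / (1 - 2 * t * v))) := by
  have hr : 0 < 1 - 2 * t * v := by linarith
  rcases eq_or_ne v 0 with rfl | hv
  · simp [gaussianReal_zero_var]
  have hv' : (0 : ℝ) < v := by positivity
  set r := 1 - 2 * t * v with hrdef
  set v' : ℝ≥0 := ⟨v / r, by positivity⟩ with hv'def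
  have hv0 : v' ≠ 0 := by
    rw [← NNReal.coe_ne_zero]
    exact (div_pos hv' hr).ne'
  have hcv : (v' : ℝ) = v / r := rfl
  rw [gaussianReal_of_var_ne_zero _ hv, lintegral_withDensity_eq_lintegral_mul _
    (measurable_gaussianPDF m v) (by fun_prop)]
  -- Completing the square: exp(t x²) times the density of N(m, v) is a constant times the density
  -- of N(m / r, v / r), with r = 1 - 2tv.
  have key : ∀ x, (gaussianPDF m v * fun x => ENNReal.ofReal (Real.exp (t * x ^ 2))) x =
      ENNReal.ofReal ((√r)⁻¹ * Real.exp (t * m ^ 2 / r)) * gaussianPDF (m / r) v' x := by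
    intro x
    simp only [Pi.mul_apply, gaussianPDF]
    rw [← ENNReal.ofReal_mul (gaussianPDFReal_nonneg _ _ _), ← ENNReal.ofReal_mul (by positivity)]
    congr 1
    simp only [gaussianPDFReal, hcv]
    have h1 : √(2 * Real.pi * (v / r)) = √(2 * Real.pi * v) * (√r)⁻¹ := by
      rw [← mul_div_assoc, Real.sqrt_div (by positivity), div_eq_mul_inv]
    have h2 : Real.exp (-(x - m) ^ 2 / (2 * v)) * Real.exp (t * x ^ 2) =
        Real.exp (t * m ^ 2 / r) * Real.exp (-(x - m / r) ^ 2 / (2 * (v / r))) := by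
      rw [← Real.exp_add, ← Real.exp_add]
      congr 1
      have hne := hr.ne'
      field_simp
      rw [hrdef]
      ring
    have hs : √r ≠ 0 := (Real.sqrt_pos.2 hr).ne'
    rw [h1, mul_inv, inv_inv, mul_assoc, h2]
    field_simp
  simp_rw [key]
  rw [lintegral_const_mul _ (measurable_gaussianPDF _ _), lintegral_gaussianPDF_eq_one _ hv0,
    mul_one]

/-! ### The linear model -/

section LinearModel

variable {d : ℕ} (Q : Measure (Vec d)) (θs : Vec d) (σ : ℝ)

theorem measurable_linearModel_map (θs : Vec d) :
    Measurable fun w : Vec d × ℝ => ((w.1, inner ℝ θs w.1 + w.2) : Pair d) := by fun_prop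

instance isProbabilityMeasure_linearModel [IsProbabilityMeasure Q] : IsProbabilityMeasure (linearModel Q θs σ) :=
  Measure.isProbabilityMeasure_map (measurable_linearModel_map θs).aemeasurable

theorem linearModel_map_fst : (linearModel Q θs σ).map Prod.fst = Q := by
  rw [linearModel, Measure.map_map measurable_fst (measurable_linearModel_map θs)]
  exact Measure.fst_prod

theorem linearModel_map_residual [IsProbabilityMeasure Q] :
    (linearModel Q θs σ).map (fun z => z.2 - inner ℝ θs z.1) =
      gaussianReal 0 (σ ^ 2).toNNReal := by
  rw [linearModel, Measure.map_map (by fun_prop) (measurable_linearModel_map θs)]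
  have : ((fun z : Pair d => z.2 - inner ℝ θs z.1) ∘
      fun w : Vec d × ℝ => ((w.1, inner ℝ θs w.1 + w.2) : Pair d)) = Prod.snd := by
    ext w; simp
  rw [this]
  exact Measure.snd_prod

theorem lintegral_linearModel_fst {f : Vec d → ℝ≥0∞} (hf : Measurable f) :
    ∫⁻ z, f z.1 ∂(linearModel Q θs σ) = ∫⁻ x, f x ∂Q := by
  conv_rhs => rw [← linearModel_map_fst Q θs σ]
  rw [lintegral_map hf measurable_fst]

theorem energy_linearModel (θ : Vec d) :
    energy (linearModel Q θs σ) θ = ∫ x, (inner ℝ θ x) ^ 2 ∂Q := by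
  conv_rhs => rw [← linearModel_map_fst Q θs σ]
  rw [integral_map (by fun_prop) (by fun_prop), energy]

theorem lintegral_linearModel_residual [IsProbabilityMeasure Q] {f : ℝ → ℝ≥0∞} (hf : Measurable f) :
    ∫⁻ z, f (z.2 - inner ℝ θs z.1) ∂(linearModel Q θs σ) =
      ∫⁻ x, f x ∂(gaussianReal 0 (σ ^ 2).toNNReal) := by
  rw [← linearModel_map_residual Q θs σ, lintegral_map hf (by fun_prop)]

variable {Q}

theorem memLp_inner (hQ : MemLp (fun x : Vec d => x) 2 Q) (θ : Vec d) :
    MemLp (fun x : Vec d => inner ℝ θ x) 2 Q := hQ.const_inner θ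

theorem integrable_inner_mul_inner (hQ : MemLp (fun x : Vec d => x) 2 Q) (θ θ' : Vec d) :
    Integrable (fun x : Vec d => inner ℝ θ x * inner ℝ θ' x) Q :=
  (memLp_inner hQ θ).integrable_mul (memLp_inner hQ θ')

theorem integrable_inner_sq (hQ : MemLp (fun x : Vec d => x) 2 Q) (θ : Vec d) :
    Integrable (fun x : Vec d => (inner ℝ θ x) ^ 2) Q := (memLp_inner hQ θ).integrable_sq

/-- The energy is positive definite when the Gram matrix has full rank. -/
theorem energy_pos_of_rank_gram (hQ : MemLp (fun x : Vec d => x) 2 Q) (hG : (gram Q).rank = d)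
    {θ : Vec d} (hθ : θ ≠ 0) : 0 < ∫ x, (inner ℝ θ x) ^ 2 ∂Q := by
  have h0 : 0 ≤ ∫ x, (inner ℝ θ x) ^ 2 ∂Q := integral_nonneg fun x => sq_nonneg _
  refine lt_of_le_of_ne h0 fun h => hθ ?_
  have hae := (integral_eq_zero_iff_of_nonneg (fun x => sq_nonneg _)
    (integrable_inner_sq hQ θ)).1 h.symm
  -- Zero energy means ⟨θ, x⟩ = 0 almost surely, so each coordinate E[xᵢ⟨θ, x⟩] of Gθ vanishes. Full
  -- rank then gives θ = 0.
  have hmul : (gram Q).mulVec θ.ofLp = 0 := by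
    ext i
    have hx : ∀ i (x : Vec d), x i = inner ℝ (EuclideanSpace.single i (1 : ℝ)) x := by
      intro i x; simp [EuclideanSpace.inner_single_left]
    have hint : ∀ j, Integrable (fun x : Vec d => x i * x j) Q := fun j => by
      simpa only [← hx] using integrable_inner_mul_inner hQ
        (EuclideanSpace.single i (1 : ℝ)) (EuclideanSpace.single j (1 : ℝ))
    simp only [Matrix.mulVec, dotProduct, gram, Matrix.of_apply, Pi.zero_apply]
    simp_rw [← integral_mul_const]
    rw [← integral_finsetSum _ fun j _ => (hint j).mul_const _]
    refine integral_eq_zero_of_ae ?_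
    filter_upwards [hae] with x hx0
    have hx0' : inner ℝ θ x = 0 := by simpa using hx0
    rw [PiLp.inner_apply] at hx0'
    simp only [Pi.zero_apply, mul_assoc]
    rw [← Finset.mul_sum]
    refine mul_eq_zero_of_right _ ?_
    simpa using hx0'
  have hinj : LinearIndependent ℝ (gram Q).col := by
    rw [linearIndependent_iff_card_eq_finrank_span, Set.finrank,
      ← Matrix.rank_eq_finrank_span_cols, hG, Fintype.card_fin]
  have := Matrix.mulVec_injective_iff.2 hinj (a₁ := θ.ofLp) (a₂ := 0) (by simp [hmul])
  exact (WithLp.ofLp_eq_zero 2).1 this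

theorem energy_eq_sum_gram (hQ : MemLp (fun x : Vec d => x) 2 Q) (θ : Vec d) :
    ∫ x, (inner ℝ θ x) ^ 2 ∂Q = ∑ i, ∑ j, θ i * θ j * gram Q i j := by
  have hx : ∀ i (x : Vec d), x i = inner ℝ (EuclideanSpace.single i (1 : ℝ)) x := by
    intro i x; simp [EuclideanSpace.inner_single_left]
  have hint : ∀ i j, Integrable (fun x : Vec d => x i * x j) Q := fun i j => by
    simpa only [← hx] using integrable_inner_mul_inner hQ
      (EuclideanSpace.single i (1 : ℝ)) (EuclideanSpace.single j (1 : ℝ))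
  have : ∀ x : Vec d, (inner ℝ θ x) ^ 2 = ∑ i, ∑ j, θ i * θ j * (x i * x j) := fun x => by
    rw [PiLp.inner_apply, sq, Finset.sum_mul_sum]
    refine Finset.sum_congr rfl fun i _ => Finset.sum_congr rfl fun j _ => ?_
    simp; ring
  simp_rw [this]
  rw [integral_finsetSum _ fun i _ => integrable_finsetSum _ fun j _ => (hint i j).const_mul _]
  refine Finset.sum_congr rfl fun i _ => ?_
  rw [integral_finsetSum _ fun j _ => (hint i j).const_mul _]
  refine Finset.sum_congr rfl fun j _ => ?_
  rw [integral_const_mul]; rfl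

theorem continuous_energy (hQ : MemLp (fun x : Vec d => x) 2 Q) :
    Continuous fun θ : Vec d => ∫ x, (inner ℝ θ x) ^ 2 ∂Q := by
  simp_rw [energy_eq_sum_gram hQ]
  fun_prop

theorem residual_sq_eq (θ x : Vec d) (y : ℝ) :
    (inner ℝ θs x + y - inner ℝ θ x) ^ 2 =
      y ^ 2 + ((-2 * inner ℝ (θ - θs) x) * y + (inner ℝ (θ - θs) x) ^ 2) := by
  rw [inner_sub_left]; ring

theorem integrable_and_integral_residual_sq [IsProbabilityMeasure Q]
    (hQ : MemLp (fun x : Vec d => x) 2 Q) (θ : Vec d) :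
    Integrable (fun w : Vec d × ℝ => (inner ℝ θs w.1 + w.2 - inner ℝ θ w.1) ^ 2)
        (Q.prod (gaussianReal 0 (σ ^ 2).toNNReal)) ∧
      ∫ w : Vec d × ℝ, (inner ℝ θs w.1 + w.2 - inner ℝ θ w.1) ^ 2
        ∂(Q.prod (gaussianReal 0 (σ ^ 2).toNNReal)) =
      σ ^ 2 + ∫ x, (inner ℝ (θ - θs) x) ^ 2 ∂Q := by
  set γ := gaussianReal 0 (σ ^ 2).toNNReal
  have h2 : Integrable (fun y : ℝ => y ^ 2) γ := integrable_pow_gaussianReal _ _ 2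
  have h1 : Integrable (fun y : ℝ => y) γ := by
    simpa using integrable_pow_gaussianReal 0 (σ ^ 2).toNNReal 1
  have hi := integrable_inner_sq hQ (θ - θs)
  have hi1 : Integrable (fun x : Vec d => -2 * inner ℝ (θ - θs) x) Q :=
    ((memLp_inner hQ (θ - θs)).integrable (by norm_num)).const_mul _
  have hi12 : Integrable (fun w : Vec d × ℝ => -2 * inner ℝ (θ - θs) w.1 * w.2) (Q.prod γ) :=
    hi1.mul_prod h1
  have hi' : Integrable (fun w : Vec d × ℝ => (inner ℝ (θ - θs) w.1) ^ 2) (Q.prod γ) :=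
    hi.comp_fst γ
  have h2' : Integrable (fun w : Vec d × ℝ => w.2 ^ 2) (Q.prod γ) := h2.comp_snd Q
  have hsum : Integrable (fun w : Vec d × ℝ => -2 * inner ℝ (θ - θs) w.1 * w.2 +
      (inner ℝ (θ - θs) w.1) ^ 2) (Q.prod γ) := hi12.add hi'
  simp_rw [residual_sq_eq]
  refine ⟨h2'.add hsum, ?_⟩
  have hγ : ∫ y, y ∂γ = 0 := integral_id_gaussianReal
  have hγ2 : ∫ y, y ^ 2 ∂γ = σ ^ 2 := by
    rw [integral_sq_gaussianReal]
    simp [Real.coe_toNNReal _ (sq_nonneg σ)]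
  rw [integral_add h2' hsum, integral_add hi12 hi',
    integral_prod_mul (μ := Q) (ν := γ) (fun x => -2 * inner ℝ (θ - θs) x) (fun y => y),
    integral_fun_snd (μ := Q) (ν := γ) (fun y => y ^ 2),
    integral_fun_fst (μ := Q) (ν := γ) (fun x => (inner ℝ (θ - θs) x) ^ 2)]
  simp [hγ, hγ2]

theorem integrable_residual_sq [IsProbabilityMeasure Q] (hQ : MemLp (fun x : Vec d => x) 2 Q)
    (θ : Vec d) : Integrable (fun z => (z.2 - inner ℝ θ z.1) ^ 2) (linearModel Q θs σ) := by
  rw [linearModel, integrable_map_measure (by fun_prop)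
    (measurable_linearModel_map θs).aemeasurable]
  exact (integrable_and_integral_residual_sq θs σ hQ θ).1

theorem risk_linearModel [IsProbabilityMeasure Q] (hQ : MemLp (fun x : Vec d => x) 2 Q)
    (θ : Vec d) :
    risk (linearModel Q θs σ) θ = σ ^ 2 + energy (linearModel Q θs σ) (θ - θs) := by
  rw [energy_linearModel, risk, linearModel,
    integral_map (measurable_linearModel_map θs).aemeasurable (by fun_prop)]
  exact (integrable_and_integral_residual_sq θs σ hQ θ).2

theorem energy_nonneg (P : Measure (Pair d)) (θ : Vec d) : 0 ≤ energy P θ :=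
  integral_nonneg fun _ => sq_nonneg _

theorem energy_zero (P : Measure (Pair d)) : energy P 0 = 0 := by simp [energy]

/-- At the point 0 the residual is 0, and the residual has a Gaussian law without atoms. Hence,
almost surely, an observation is null exactly when it is censored. -/
theorem linearModel_singleton_zero [IsProbabilityMeasure Q] (hσ : 0 < σ) : linearModel Q θs σ {0} = 0 := by
  have hv : (σ ^ 2).toNNReal ≠ 0 := by simpa using hσ.ne'
  have := nullSingletonClass_gaussianReal (μ := 0) hv
  have h : (linearModel Q θs σ).map (fun z => z.2 - inner ℝ θs z.1) {0} = 0 := by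
    rw [linearModel_map_residual]; exact measure_singleton 0
  rw [Measure.map_apply (by fun_prop) (measurableSet_singleton 0)] at h
  refine measure_mono_null ?_ h
  rintro z rfl
  simp

end LinearModel

/-! ### Censoring -/

section Censoring

variable {d : ℕ} (P : Measure (Pair d)) [IsProbabilityMeasure P] (p : unitInterval)

/-- The mixture form explains the effect of censoring on moments: the atom at 0 contributes nothing
to an integrand that vanishes there. -/
theorem censored_eq :
    censored P p = ENNReal.ofReal p • P + ENNReal.ofReal (1 - p) • Measure.dirac 0 := by
  have hm : Measurable fun w : ℝ × Pair d => ((w.1 • w.2.1, w.1 * w.2.2) : Pair d) := by fun_prop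
  have h1 : ((fun w : ℝ × Pair d => ((w.1 • w.2.1, w.1 * w.2.2) : Pair d)) ∘ Prod.mk 1) = id := by
    ext z <;> simp
  have h0 : ((fun w : ℝ × Pair d => ((w.1 • w.2.1, w.1 * w.2.2) : Pair d)) ∘ Prod.mk 0) =
      fun _ => 0 := by
    ext z <;> simp
  rw [censored, bernoulliMeasure_def, Measure.add_prod, Measure.prod_smul_left,
    Measure.prod_smul_left, Measure.map_add _ _ hm, Measure.map_smul, Measure.map_smul,
    Measure.dirac_prod, Measure.dirac_prod, Measure.map_map hm (by fun_prop),
    Measure.map_map hm (by fun_prop), h1, h0, Measure.map_id, Measure.map_const]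
  congr 1
  · rw [ENNReal.smul_def]; congr 1
    rw [ENNReal.ofReal]; congr 1; ext
    simp [p.2.1]
  · rw [measure_univ, one_smul, ENNReal.smul_def]; congr 1
    rw [ENNReal.ofReal]; congr 1; ext
    simp [p.2.2]

instance isProbabilityMeasure_censored : IsProbabilityMeasure (censored P p) :=
  have : Measurable fun w : ℝ × Pair d => ((w.1 • w.2.1, w.1 * w.2.2) : Pair d) := by fun_prop
  Measure.isProbabilityMeasure_map this.aemeasurable

theorem lintegral_censored {f : Pair d → ℝ≥0∞} (hf0 : f 0 = 0) :
    ∫⁻ z, f z ∂(censored P p) = ENNReal.ofReal p * ∫⁻ z, f z ∂P := by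
  rw [censored_eq, lintegral_add_measure, lintegral_smul_measure, lintegral_smul_measure,
    lintegral_dirac, hf0]
  simp

theorem risk_censored (θ : Vec d) (hint : Integrable (fun z => (z.2 - inner ℝ θ z.1) ^ 2) P) :
    risk (censored P p) θ = p * risk P θ := by
  rw [risk, censored_eq, integral_add_measure (hint.smul_measure ENNReal.ofReal_ne_top)
    ((integrable_dirac (by simp)).smul_measure ENNReal.ofReal_ne_top),
    integral_smul_measure, integral_smul_measure, integral_dirac, risk]
  simp [p.2.1]

/-- The design kurtosis is inversely proportional to the censoring parameter. -/
theorem kappa1_censored (hp : 0 < p) :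
    kappa1 (censored P p) = kappa1 P / ENNReal.ofReal p := by
  have hp' : 0 < (p : ℝ) := hp
  set q := ENNReal.ofReal p with hq
  have hq0 : q ≠ 0 := by simpa [hq] using hp'
  have hqt : q ≠ ∞ := ENNReal.ofReal_ne_top
  have hs : 0 < √(p : ℝ) := Real.sqrt_pos.2 hp'
  have hs2 : √(p : ℝ) ^ 2 = p := Real.sq_sqrt hp'.le
  have e2 : ∀ (θ : Vec d) (a : ℝ), ∫⁻ z, ENNReal.ofReal ((inner ℝ (a • θ) z.1) ^ 2) ∂P =
      ENNReal.ofReal (a ^ 2) * ∫⁻ z, ENNReal.ofReal ((inner ℝ θ z.1) ^ 2) ∂P := fun θ a => by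
    rw [← lintegral_const_mul _ (by fun_prop)]
    refine lintegral_congr fun z => ?_
    rw [← ENNReal.ofReal_mul (sq_nonneg _), inner_smul_left]
    simp [mul_pow]
  have e4 : ∀ (θ : Vec d) (a : ℝ), ∫⁻ z, ENNReal.ofReal ((inner ℝ (a • θ) z.1) ^ 4) ∂P =
      ENNReal.ofReal (a ^ 4) * ∫⁻ z, ENNReal.ofReal ((inner ℝ θ z.1) ^ 4) ∂P := fun θ a => by
    rw [← lintegral_const_mul _ (by fun_prop)]
    refine lintegral_congr fun z => ?_
    rw [← ENNReal.ofReal_mul (by positivity), inner_smul_left]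
    simp [mul_pow]
  have c2 : ∀ θ : Vec d, ∫⁻ z, ENNReal.ofReal ((inner ℝ θ z.1) ^ 2) ∂(censored P p) =
      q * ∫⁻ z, ENNReal.ofReal ((inner ℝ θ z.1) ^ 2) ∂P := fun θ =>
    lintegral_censored P p (by simp)
  have c4 : ∀ θ : Vec d, ∫⁻ z, ENNReal.ofReal ((inner ℝ θ z.1) ^ 4) ∂(censored P p) =
      q * ∫⁻ z, ENNReal.ofReal ((inner ℝ θ z.1) ^ 4) ∂P := fun θ =>
    lintegral_censored P p (by simp)
  have q4 : ENNReal.ofReal (√(p : ℝ) ^ 4) = q * q := by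
    rw [show √(p : ℝ) ^ 4 = √(p : ℝ) ^ 2 * √(p : ℝ) ^ 2 by ring, hs2, ENNReal.ofReal_mul hp'.le]
  apply le_antisymm
  · refine iSup₂_le fun θ hθ => ?_
    rw [c2] at hθ
    rw [c4, ENNReal.le_div_iff_mul_le (Or.inl hq0) (Or.inl hqt)]
    -- Scaling by √p exchanges the two constraints: the uncensored second moment of √p θ is the
    -- censored one of θ, while fourth moments pick up p². The converse inequality scales by 1/√p.
    refine le_trans (le_of_eq ?_) (le_iSup₂_of_le (√(p : ℝ) • θ) (by rw [e2, hs2]; exact hθ) le_rfl)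
    rw [e4, q4]; ring
  · rw [ENNReal.div_le_iff_le_mul (Or.inl hq0) (Or.inl hqt)]
    refine iSup₂_le fun θ hθ => ?_
    have hb : ENNReal.ofReal ((√(p : ℝ))⁻¹ ^ 2) = q⁻¹ := by
      rw [inv_pow, hs2, ENNReal.ofReal_inv_of_pos hp']
    have hb4 : ENNReal.ofReal ((√(p : ℝ))⁻¹ ^ 4) = q⁻¹ * q⁻¹ := by
      rw [inv_pow, ENNReal.ofReal_inv_of_pos (by positivity), q4, ENNReal.mul_inv (by simp [hq0])
        (by simp [hq0])]
    have hle : ∫⁻ z, ENNReal.ofReal ((inner ℝ ((√(p : ℝ))⁻¹ • θ) z.1) ^ 4) ∂(censored P p) ≤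
        kappa1 (censored P p) := by
      refine le_iSup₂_of_le ((√(p : ℝ))⁻¹ • θ) ?_ le_rfl
      rw [c2, e2, hb, ← mul_assoc, ENNReal.mul_inv_cancel hq0 hqt, one_mul]
      exact hθ
    rw [c4, e4, hb4] at hle
    calc ∫⁻ z, ENNReal.ofReal ((inner ℝ θ z.1) ^ 4) ∂P
        = (q * (q⁻¹ * q⁻¹ * ∫⁻ z, ENNReal.ofReal ((inner ℝ θ z.1) ^ 4) ∂P)) * q := by
          have := ENNReal.mul_inv_cancel hq0 hqt
          calc _ = (q * q⁻¹) * (q * q⁻¹) *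
                ∫⁻ z, ENNReal.ofReal ((inner ℝ θ z.1) ^ 4) ∂P := by rw [this]; simp
            _ = _ := by ring
      _ ≤ _ := by gcongr

/-- The noise kurtosis is inversely proportional to the censoring parameter. -/
theorem kappa2_censored (hp : 0 < p) (θs : Vec d)
    (h0 : 0 < ∫⁻ z, ENNReal.ofReal ((z.2 - inner ℝ θs z.1) ^ 2) ∂P) :
    kappa2 (censored P p) θs = kappa2 P θs / ENNReal.ofReal p := by
  have hp' : 0 < (p : ℝ) := hp
  have hq0 : ENNReal.ofReal (p : ℝ) ≠ 0 := by simpa using hp'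
  have hqt : ENNReal.ofReal (p : ℝ) ≠ ∞ := ENNReal.ofReal_ne_top
  have hc2 : ∫⁻ z, ENNReal.ofReal ((z.2 - inner ℝ θs z.1) ^ 2) ∂(censored P p) =
      ENNReal.ofReal p * ∫⁻ z, ENNReal.ofReal ((z.2 - inner ℝ θs z.1) ^ 2) ∂P :=
    lintegral_censored P p (by simp)
  have hc4 : ∫⁻ z, ENNReal.ofReal ((z.2 - inner ℝ θs z.1) ^ 4) ∂(censored P p) =
      ENNReal.ofReal p * ∫⁻ z, ENNReal.ofReal ((z.2 - inner ℝ θs z.1) ^ 4) ∂P :=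
    lintegral_censored P p (by simp)
  have hpos := ENNReal.mul_pos hq0 h0.ne'
  rw [kappa2, kappa2, hc2, hc4, if_pos hpos, if_pos h0, mul_pow, sq (ENNReal.ofReal (p : ℝ)),
    mul_assoc, ENNReal.mul_div_mul_left _ _ hq0 hqt, div_eq_mul_inv, div_eq_mul_inv,
    div_eq_mul_inv, ENNReal.mul_inv (Or.inl hq0) (Or.inl hqt)]
  ring

end Censoring

theorem kappa2_linearModel {d : ℕ} (Q : Measure (Vec d)) [IsProbabilityMeasure Q] (θs : Vec d)
    {σ : ℝ} (hσ : 0 < σ) : kappa2 (linearModel Q θs σ) θs = 3 := by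
  have hc2 : ∫⁻ z, ENNReal.ofReal ((z.2 - inner ℝ θs z.1) ^ 2) ∂(linearModel Q θs σ) =
      ENNReal.ofReal (σ ^ 2) := by
    rw [lintegral_linearModel_residual Q θs σ (f := fun y => ENNReal.ofReal (y ^ 2)) (by fun_prop),
      lintegral_sq_gaussianReal]
    simp [Real.coe_toNNReal _ (sq_nonneg σ)]
  have hc4 : ∫⁻ z, ENNReal.ofReal ((z.2 - inner ℝ θs z.1) ^ 4) ∂(linearModel Q θs σ) =
      3 * ENNReal.ofReal (σ ^ 2) ^ 2 := by
    rw [lintegral_linearModel_residual Q θs σ (f := fun y => ENNReal.ofReal (y ^ 4)) (by fun_prop),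
      lintegral_pow_four_gaussianReal]
    rw [Real.coe_toNNReal _ (sq_nonneg σ)]
    rw [show (0 : ℝ) ^ 4 + 6 * 0 ^ 2 * σ ^ 2 + 3 * (σ ^ 2) ^ 2 = 3 * (σ ^ 2) ^ 2 by ring,
      ENNReal.ofReal_mul (by norm_num), ENNReal.ofReal_pow (sq_nonneg σ)]
    simp
  have h0 : 0 < ENNReal.ofReal (σ ^ 2) := by simpa using pow_pos hσ 2
  rw [kappa2, hc2, hc4, if_pos h0]
  exact ENNReal.mul_div_cancel_right (pow_ne_zero 2 h0.ne')
    (ENNReal.pow_ne_top ENNReal.ofReal_ne_top)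

/-! ### Lower tail of the projection of a Gaussian noise -/

/-- The image of a standard Gaussian law by the adjoint of an isometry is standard Gaussian. -/
theorem stdGaussian_map_adjoint {E F : Type*} [NormedAddCommGroup E] [InnerProductSpace ℝ E]
    [FiniteDimensional ℝ E] [MeasurableSpace E] [BorelSpace E] [NormedAddCommGroup F]
    [InnerProductSpace ℝ F] [FiniteDimensional ℝ F] [MeasurableSpace F] [BorelSpace F]
    (V : F →ₗᵢ[ℝ] E) {L : E →L[ℝ] F} (hL : ∀ y t, inner ℝ (L y) t = inner ℝ y (V t)) :
    (stdGaussian E).map L = stdGaussian F := by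
  refine Measure.ext_of_charFun ?_
  ext t
  rw [charFun_apply, integral_map (by fun_prop) (by fun_prop), charFun_stdGaussian]
  simp_rw [hL]
  rw [← charFun_apply, charFun_stdGaussian, V.norm_map]

/-- Chernoff's bound at parameter -1/2, where the Laplace transform of the square of a standard
normal variable is 1/√2. This is the origin of d log 2 in the theorem. -/
theorem stdGaussian_norm_sq_le (d : ℕ) (c : ℝ) :
    stdGaussian (Vec d) {t | ‖t‖ ^ 2 ≤ c} ≤
      ENNReal.ofReal (Real.exp (c / 2)) * ENNReal.ofReal (√2)⁻¹ ^ d := by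
  rw [← map_pi_eq_stdGaussian, Measure.map_apply (by fun_prop)
    (measurableSet_le (by fun_prop) measurable_const)]
  have h := measure_pi_le_sum_le (gaussianReal 0 1) d (φ := fun x => (-1 / 2) * x ^ 2)
    (by fun_prop) (-(c / 2))
  have h2 : (1 : ℝ) - 2 * (-1 / 2) * ((1 : ℝ≥0) : ℝ) = 2 := by norm_num
  rw [lintegral_exp_mul_sq_gaussianReal 0 1 (t := -1 / 2) (by norm_num), neg_neg, h2] at h
  simp only [ne_eq, OfNat.ofNat_ne_zero, not_false_eq_true, zero_pow, mul_zero, zero_div,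
    Real.exp_zero, mul_one] at h
  refine le_trans (measure_mono fun z hz => ?_) h
  have hz' : ∑ i, z i ^ 2 ≤ c := by
    simpa [EuclideanSpace.real_norm_sq_eq] using hz
  simp only [Set.mem_ofPred_eq, ← Finset.mul_sum]
  linarith

/-- If `η` is a standard Gaussian vector of `ℝⁿ`, the squared norm of its projection on the
`d`-dimensional space `{(⟨u, xᵢ⟩)ᵢ}` has a chi-square law, of which this bounds the lower tail. -/
theorem gaussian_projection_tail {d n : ℕ} (x : Fin n → Vec d)
    (hx : ∀ u, (∀ i, inner ℝ u (x i) = 0) → u = 0) (c : ℝ) :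
    Measure.pi (fun _ : Fin n => gaussianReal 0 1)
      {η | ∀ u, 2 * ∑ i, η i * inner ℝ u (x i) - ∑ i, (inner ℝ u (x i)) ^ 2 ≤ c} ≤
      ENNReal.ofReal (Real.exp (c / 2)) * ENNReal.ofReal (√2)⁻¹ ^ d := by
  let T : Vec d →ₗ[ℝ] EuclideanSpace ℝ (Fin n) :=
    { toFun := fun u => WithLp.toLp 2 fun i => inner ℝ u (x i)
      map_add' := fun u v => by ext i; simp [inner_add_left]
      map_smul' := fun a u => by ext i; simp [inner_smul_left] }
  have hTi : ∀ u i, T u i = inner ℝ u (x i) := fun _ _ => rfl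
  have hT : Function.Injective T := by
    rw [injective_iff_map_eq_zero]
    intro u hu
    refine hx u fun i => ?_
    rw [← hTi, hu]; rfl
  have hfr : Module.finrank ℝ (LinearMap.range T) = d := by
    rw [LinearMap.finrank_range_of_inj hT]; simp
  let b := (stdOrthonormalBasis ℝ (LinearMap.range T)).reindex (finCongr hfr)
  -- `V` parametrizes the range of `T` isometrically, so its adjoint `L` yields the coordinates of
  -- the orthogonal projection on this range. `L` therefore sends a standard Gaussian vector of ℝⁿ
  -- to one of ℝ^d.
  let V : Vec d →ₗᵢ[ℝ] EuclideanSpace ℝ (Fin n) :=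
    (LinearMap.range T).subtypeₗᵢ.comp b.repr.symm.toLinearIsometry
  have hV : ∀ t, ∃ u, T u = V t := fun t => (b.repr.symm t).2
  let L : EuclideanSpace ℝ (Fin n) →L[ℝ] Vec d :=
    ContinuousLinearMap.adjoint V.toContinuousLinearMap
  have hL : ∀ y t, inner ℝ (L y) t = inner ℝ y (V t) := fun y t =>
    ContinuousLinearMap.adjoint_inner_left V.toContinuousLinearMap t y
  refine le_trans ?_ (stdGaussian_norm_sq_le d c)
  have hm : MeasurableSet {t : Vec d | ‖t‖ ^ 2 ≤ c} :=
    measurableSet_le (by fun_prop) measurable_const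
  rw [← stdGaussian_map_adjoint V hL, ← map_pi_eq_stdGaussian,
    Measure.map_apply (by fun_prop) hm,
    Measure.map_apply (by fun_prop) (L.continuous.measurable hm)]
  refine measure_mono fun η hη => ?_
  set y : EuclideanSpace ℝ (Fin n) := WithLp.toLp 2 η
  -- This `u` attains the maximum: `T u` is the projection of the noise, and the gain there is ‖L
  -- y‖².
  obtain ⟨u, hu⟩ := hV (L y)
  have h := hη u
  have h1 : ∑ i, η i * inner ℝ u (x i) = ‖L y‖ ^ 2 := by
    rw [← real_inner_self_eq_norm_sq, hL, ← hu, PiLp.inner_apply]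
    simp [hTi, y, mul_comm]
  have h2 : ∑ i, (inner ℝ u (x i)) ^ 2 = ‖L y‖ ^ 2 := by
    rw [← V.norm_map, ← hu, EuclideanSpace.real_norm_sq_eq]
    simp [hTi]
  rw [h1, h2] at h
  change ‖L y‖ ^ 2 ≤ c
  linarith

/-- Replacing η by ση and u by σu multiplies the gain by σ², which reduces to unit variance. -/
theorem gaussian_projection_tail_of_variance {d n : ℕ} (x : Fin n → Vec d)
    (hx : ∀ u, (∀ i, inner ℝ u (x i) = 0) → u = 0) {σ : ℝ} (hσ : 0 < σ) (c : ℝ) :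
    Measure.pi (fun _ : Fin n => gaussianReal 0 (σ ^ 2).toNNReal)
      {η | ∀ u, 2 * ∑ i, η i * inner ℝ u (x i) - ∑ i, (inner ℝ u (x i)) ^ 2 ≤ c * σ ^ 2} ≤
      ENNReal.ofReal (Real.exp (c / 2)) * ENNReal.ofReal (√2)⁻¹ ^ d := by
  have hg : gaussianReal 0 (σ ^ 2).toNNReal = (gaussianReal 0 1).map (σ * ·) := by
    rw [gaussianReal_map_const_mul]
    congr 1
    · simp
    · ext; simp [Real.coe_toNNReal _ (sq_nonneg σ)]
  have hpi : Measure.pi (fun _ : Fin n => gaussianReal 0 (σ ^ 2).toNNReal) =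
      (Measure.pi fun _ : Fin n => gaussianReal 0 1).map (fun η i => σ * η i) := by
    rw [Measure.pi_map_pi (fun _ => by fun_prop), ← hg]
  have hm : MeasurableSet {η : Fin n → ℝ | ∀ u : Vec d,
      2 * ∑ i, η i * inner ℝ u (x i) - ∑ i, (inner ℝ u (x i)) ^ 2 ≤ c * σ ^ 2} :=
    measurableSet_forall_le_of_continuous (fun _ => by fun_prop) (fun _ => by fun_prop)
      (fun _ => by fun_prop) (fun _ => by fun_prop)
  rw [hpi, Measure.map_apply (by fun_prop) hm]
  refine le_trans (measure_mono ?_) (gaussian_projection_tail x hx c)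
  intro η hη u
  have h := hη (σ • u)
  have h1 : ∑ i, σ * η i * inner ℝ (σ • u) (x i) = σ ^ 2 * ∑ i, η i * inner ℝ u (x i) := by
    rw [Finset.mul_sum]
    refine Finset.sum_congr rfl fun i _ => ?_
    rw [inner_smul_left]; simp; ring
  have h2 : ∑ i, (inner ℝ (σ • u) (x i)) ^ 2 = σ ^ 2 * ∑ i, (inner ℝ u (x i)) ^ 2 := by
    rw [Finset.mul_sum]
    refine Finset.sum_congr rfl fun i _ => ?_
    rw [inner_smul_left]; simp; ring
  rw [h1, h2] at h
  have : σ ^ 2 * (2 * ∑ i, η i * inner ℝ u (x i) - ∑ i, (inner ℝ u (x i)) ^ 2) ≤ σ ^ 2 * c := by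
    linarith
  exact le_of_mul_le_mul_left this (by positivity)

/-- The level d log 2 - 2 log ε⁻¹ is chosen exactly so that the chi-square tail bound equals ε. -/
theorem ofReal_exp_mul_sqrt_two_inv_pow (d : ℕ) {ε : ℝ} (hε : 0 < ε) :
    ENNReal.ofReal (Real.exp ((d * Real.log 2 - 2 * Real.log ε⁻¹) / 2)) *
      ENNReal.ofReal (√2)⁻¹ ^ d = ENNReal.ofReal ε := by
  rw [← ENNReal.ofReal_pow (by positivity), ← ENNReal.ofReal_mul (by positivity)]
  congr 1
  have : (√2)⁻¹ = Real.exp (-(Real.log 2 / 2)) := by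
    rw [Real.exp_neg, Real.sqrt_eq_rpow, Real.rpow_def_of_pos (by norm_num)]
    congr 2; ring
  rw [this, ← Real.exp_nat_mul, ← Real.exp_add, Real.log_inv]
  rw [show (d * Real.log 2 - 2 * -Real.log ε) / 2 + d * -(Real.log 2 / 2) = Real.log ε by ring,
    Real.exp_log hε]

/-! ### Samples of the linear model -/

/-- A sample of the linear model is made of independent samples of the design and the noise. -/
theorem pi_linearModel {d : ℕ} (Q : Measure (Vec d)) [IsProbabilityMeasure Q] (θs : Vec d) (σ : ℝ)
    (n : ℕ) :
    Measure.pi (fun _ : Fin n => linearModel Q θs σ) =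
      ((Measure.pi fun _ : Fin n => Q).prod
        (Measure.pi fun _ : Fin n => gaussianReal 0 (σ ^ 2).toNNReal)).map
        (fun w i => ((w.1 i, inner ℝ θs (w.1 i) + w.2 i) : Pair d)) := by
  set γ := gaussianReal 0 (σ ^ 2).toNNReal
  refine Measure.pi_eq fun s hs => ?_
  rw [Measure.map_apply (by fun_prop) (MeasurableSet.univ_pi hs)]
  have hmp := measurePreserving_arrowProdEquivProdArrow (Vec d) ℝ (Fin n) (fun _ => Q) (fun _ => γ)
  rw [← hmp.map_eq, Measure.map_apply hmp.measurable
    ((MeasurableSet.univ_pi hs).preimage (by fun_prop))]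
  have : (MeasurableEquiv.arrowProdEquivProdArrow (Vec d) ℝ (Fin n)) ⁻¹'
      ((fun (w : (Fin n → Vec d) × (Fin n → ℝ)) i =>
        ((w.1 i, inner ℝ θs (w.1 i) + w.2 i) : Pair d)) ⁻¹' Set.univ.pi s) =
      Set.univ.pi fun i => (fun w : Vec d × ℝ => ((w.1, inner ℝ θs w.1 + w.2) : Pair d)) ⁻¹' s i := by
    ext w
    simp [Set.mem_pi, MeasurableEquiv.arrowProdEquivProdArrow, Equiv.arrowProdEquivProdArrow]
  rw [this, Measure.pi_pi]
  refine Finset.prod_congr rfl fun i _ => ?_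
  rw [linearModel, Measure.map_apply (measurable_linearModel_map θs) (hs i)]

/-- The decrease of the empirical risk of the sample `z` from `θs` to `θs + u`. -/
noncomputable def empGain {d n : ℕ} (θs : Vec d) (z : Fin n → Pair d) (u : Vec d) : ℝ :=
  2 * ∑ i, ((z i).2 - inner ℝ θs (z i).1) * inner ℝ u (z i).1 - ∑ i, (inner ℝ u (z i).1) ^ 2

/-- The empirical energy of the error of an empirical risk minimizer dominates the decrease of the
empirical risk in every direction. -/
theorem IsERM.empGain_le {d n : ℕ} {z : Fin n → Pair d} {θ : Vec d} (h : IsERM z θ) (θs u : Vec d) :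
    empGain θs z u ≤ ∑ i, (inner ℝ (θ - θs) (z i).1) ^ 2 := by
  have key : ∀ v : Vec d, ∑ i, ((z i).2 - inner ℝ (θs + v) (z i).1) ^ 2 =
      ∑ i, ((z i).2 - inner ℝ θs (z i).1) ^ 2 - empGain θs z v := fun v => by
    rw [empGain, Finset.mul_sum, ← Finset.sum_sub_distrib, ← Finset.sum_sub_distrib]
    refine Finset.sum_congr rfl fun i _ => ?_
    rw [inner_add_left]; ring
  have hmax : ∀ v, empGain θs z v ≤ empGain θs z (θ - θs) := fun v => by
    have := h (θs + v)
    rw [key v] at this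
    have h2 := key (θ - θs)
    rw [add_sub_cancel] at h2
    rw [h2] at this
    linarith
  set a := ∑ i, ((z i).2 - inner ℝ θs (z i).1) * inner ℝ (θ - θs) (z i).1 with ha
  set b := ∑ i, (inner ℝ (θ - θs) (z i).1) ^ 2 with hb
  have hscale : ∀ t : ℝ, empGain θs z (t • (θ - θs)) = 2 * t * a - t ^ 2 * b := fun t => by
    rw [empGain, ha, hb, Finset.mul_sum, Finset.mul_sum, Finset.mul_sum, ← Finset.sum_sub_distrib,
      ← Finset.sum_sub_distrib]
    refine Finset.sum_congr rfl fun i _ => ?_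
    rw [inner_smul_left]; simp; ring
  have h1 : empGain θs z (θ - θs) = 2 * a - b := by simpa using hscale 1
  -- Along the ray (1 + t)(θ - θs), maximality at t = 0 reads b t² - 2(a - b) t ≥ 0 for every t. The
  -- discriminant 4(a - b)² must vanish, so a = b and the maximal gain is b.
  have hd : discrim b (-(2 * (a - b))) 0 ≤ 0 := by
    refine discrim_le_zero fun t => ?_
    have := hmax ((1 + t) • (θ - θs))
    rw [hscale, h1] at this
    nlinarith
  have hab : a = b := by
    rw [discrim] at hd
    nlinarith [sq_nonneg (a - b)]
  have := hmax u
  rw [h1] at this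
  linarith

/-- With probability at most `ε` the design is
well-conditioned but the empirical risk cannot be decreased by the expected amount. -/
theorem pi_linearModel_empGain_le {d : ℕ} (Q : Measure (Vec d)) [IsProbabilityMeasure Q]
    (hQ : MemLp (fun x : Vec d => x) 2 Q) (hG : (gram Q).rank = d) (θs : Vec d) {σ ε : ℝ}
    (hσ : 0 < σ) (hε : 0 < ε) (n : ℕ) {a : ℝ} (ha : 0 < a) :
    Measure.pi (fun _ : Fin n => linearModel Q θs σ)
      ({z | ∀ u, a * energy (linearModel Q θs σ) u ≤ ∑ i, (inner ℝ u (z i).1) ^ 2} ∩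
        {z | ∀ u, empGain θs z u ≤ (d * Real.log 2 - 2 * Real.log ε⁻¹) * σ ^ 2}) ≤
      ENNReal.ofReal ε := by
  set c := d * Real.log 2 - 2 * Real.log ε⁻¹ with hc
  simp_rw [energy_linearModel]
  have hcont : Continuous fun u : Vec d => ∫ x, (inner ℝ u x) ^ 2 ∂Q := continuous_energy hQ
  have hm1 : MeasurableSet {z : Fin n → Pair d | ∀ u : Vec d,
      a * ∫ x, (inner ℝ u x) ^ 2 ∂Q ≤ ∑ i, (inner ℝ u (z i).1) ^ 2} :=
    measurableSet_forall_le_of_continuous (fun _ => by fun_prop) (fun _ => by fun_prop)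
      (fun _ => by fun_prop) (fun _ => by fun_prop)
  have hm2 : MeasurableSet {z : Fin n → Pair d | ∀ u, empGain θs z u ≤ c * σ ^ 2} := by
    unfold empGain
    exact measurableSet_forall_le_of_continuous (fun _ => by fun_prop) (fun _ => by fun_prop)
      (fun _ => by fun_prop) (fun _ => by fun_prop)
  have hmap : Measurable fun (w : (Fin n → Vec d) × (Fin n → ℝ)) (i : Fin n) =>
      ((w.1 i, inner ℝ θs (w.1 i) + w.2 i) : Pair d) := by fun_prop
  rw [pi_linearModel, Measure.map_apply hmap (hm1.inter hm2),
    Measure.prod_apply ((hm1.inter hm2).preimage hmap)]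
  refine le_trans (lintegral_mono (g := fun _ => ENNReal.ofReal ε) fun x => ?_) (by simp)
  -- The design `x` is frozen by Fubini. If it is well-conditioned it separates directions, and the
  -- Gaussian tail applies to the noise alone; otherwise the section of the event is empty.
  by_cases hx : ∀ u : Vec d, a * ∫ y, (inner ℝ u y) ^ 2 ∂Q ≤ ∑ i, (inner ℝ u (x i)) ^ 2
  · have hx' : ∀ u, (∀ i, inner ℝ u (x i) = 0) → u = 0 := fun u hu => by
      by_contra hne
      have h1 := energy_pos_of_rank_gram hQ hG hne
      have h2 := hx u
      simp only [hu] at h2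
      have := mul_pos ha h1
      simp at h2
      linarith
    refine le_trans (measure_mono ?_) ((gaussian_projection_tail_of_variance x hx' hσ c).trans
      (ofReal_exp_mul_sqrt_two_inv_pow d hε).le)
    rintro η ⟨-, hη⟩ u
    have := hη u
    simpa [empGain] using this
  · refine le_trans (le_of_eq ?_) zero_le
    convert measure_empty
    · ext η
      simp only [Set.mem_preimage, Set.mem_inter_iff, Set.mem_ofPred_eq, Set.mem_empty_iff_false,
        iff_false, not_and]
      exact fun h => absurd h hx
    all_goals infer_instance

theorem RelDevLe.bounds {a b δ : ℝ} (h : RelDevLe a b δ) (hb : 0 ≤ b) :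
    (1 - δ) * b ≤ a ∧ a ≤ (1 + δ) * b := by
  unfold RelDevLe at h
  split_ifs at h with h0
  · simp [h, h0]
  · have hb' : 0 < b := lt_of_le_of_ne hb (Ne.symm h0)
    rw [abs_le] at h
    have h1 : 1 - δ ≤ a / b := by linarith
    have h2 : a / b ≤ 1 + δ := by linarith
    exact ⟨(le_div_iff₀ hb').1 h1, (div_le_iff₀ hb').1 h2⟩

/-- The lower bound on the excess risk of empirical risk minimizers for uncensored samples. -/
theorem excess_risk_lower_bound {d : ℕ} {Q : Measure (Vec d)} [IsProbabilityMeasure Q]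
    (hQ : MemLp (fun x : Vec d => x) 2 Q) (hG : (gram Q).rank = d) (θs : Vec d) {σ ε δ : ℝ}
    (hσ : 0 < σ) (hε : 0 < ε) (hδ : δ ∈ Set.Ioo (0 : ℝ) 1) {n : ℕ} (hn : 0 < n)
    (h : SampleHolds (linearModel Q θs σ) n (1 - 2 * ε)
      (fun z => GramDevLe (linearModel Q θs σ) δ z)) :
    SampleHolds (linearModel Q θs σ) n (1 - 3 * ε) (fun z => ∀ θ, IsERM z θ →
      (d * Real.log 2 - 2 * Real.log ε⁻¹) * σ ^ 2 / ((1 + δ) * n) ≤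
        risk (linearModel Q θs σ) θ - risk (linearModel Q θs σ) θs) := by
  obtain ⟨B, hBm, hB, hBΦ⟩ := h
  set P := linearModel Q θs σ with hP
  set c := d * Real.log 2 - 2 * Real.log ε⁻¹ with hc
  have hn' : (0 : ℝ) < n := by exact_mod_cast hn
  have hm2 : MeasurableSet {z : Fin n → Pair d | ∀ u, empGain θs z u ≤ c * σ ^ 2} := by
    unfold empGain
    exact measurableSet_forall_le_of_continuous (fun _ => by fun_prop) (fun _ => by fun_prop)
      (fun _ => by fun_prop) (fun _ => by fun_prop)
  have hbd : ∀ z ∈ B, ∀ u, n * ((1 - δ) * energy P u) ≤ ∑ i, (inner ℝ u (z i).1) ^ 2 ∧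
      ∑ i, (inner ℝ u (z i).1) ^ 2 ≤ n * ((1 + δ) * energy P u) := fun z hz u => by
    have h := (hBΦ z hz u).bounds (energy_nonneg P u)
    have he : ∑ i, (inner ℝ u (z i).1) ^ 2 = n * empEnergy z u := by
      rw [empEnergy]; field_simp
    rw [he]
    exact ⟨mul_le_mul_of_nonneg_left h.1 hn'.le, mul_le_mul_of_nonneg_left h.2 hn'.le⟩
  refine ⟨B \ {z | ∀ u, empGain θs z u ≤ c * σ ^ 2}, hBm.diff hm2, ?_, ?_⟩
  -- The lower Gram bound, with a = n(1 - δ) > 0, only serves to make the design span ℝ^d. The upper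
  -- one, with 1 + δ, produces the constant.
  · have htail := pi_linearModel_empGain_le Q hQ hG θs hσ hε n
      (mul_pos hn' (sub_pos.2 hδ.2))
    have hle : Measure.pi (fun _ : Fin n => P) B ≤
        Measure.pi (fun _ : Fin n => P) (B \ {z | ∀ u, empGain θs z u ≤ c * σ ^ 2}) +
          ENNReal.ofReal ε := by
      refine le_trans (measure_mono (t := (B \ {z | ∀ u, empGain θs z u ≤ c * σ ^ 2}) ∪ _) ?_)
        ((measure_union_le _ _).trans (add_le_add_right htail _))
      intro z hz
      by_cases hz2 : ∀ u, empGain θs z u ≤ c * σ ^ 2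
      · exact Or.inr ⟨fun u => by rw [mul_assoc]; exact (hbd z hz u).1, hz2⟩
      · exact Or.inl ⟨hz, hz2⟩
    have h3 : ENNReal.ofReal (1 - 3 * ε) = ENNReal.ofReal (1 - 2 * ε) - ENNReal.ofReal ε := by
      rw [← ENNReal.ofReal_sub _ hε.le]; congr 1; ring
    rw [h3]
    exact tsub_le_iff_right.2 (hB.trans hle)
  · rintro z ⟨hz, hz2⟩ θ hθ
    simp only [Set.mem_ofPred_eq, not_forall, not_le] at hz2
    obtain ⟨u, hu⟩ := hz2
    have h1 := hθ.empGain_le θs u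
    have h2 := (hbd z hz (θ - θs)).2
    rw [hP, risk_linearModel θs σ hQ, risk_linearModel θs σ hQ, sub_self, energy_zero, ← hP]
    have hδ' : 0 < 1 + δ := by linarith [hδ.1]
    rw [div_le_iff₀ (by positivity)]
    nlinarith

/-! ### Samples of the censored law -/

theorem SampleHolds.mono {d n : ℕ} {P : Measure (Pair d)} {a b : ℝ}
    {Φ Ψ : (Fin n → Pair d) → Prop} (h : SampleHolds P n a Φ) (hab : b ≤ a)
    (hΦ : ∀ z, Φ z → Ψ z) : SampleHolds P n b Ψ := by
  obtain ⟨A, hA, hPA, hz⟩ := h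
  exact ⟨A, hA, (ENNReal.ofReal_le_ofReal hab).trans hPA, fun z h => hΦ z (hz z h)⟩

theorem SampleHolds.of_forall {d n : ℕ} {P : Measure (Pair d)} [IsProbabilityMeasure P] {a : ℝ}
    {Φ : (Fin n → Pair d) → Prop} (ha : a ≤ 1) (h : ∀ z, Φ z) : SampleHolds P n a Φ :=
  ⟨Set.univ, MeasurableSet.univ, by simpa using ENNReal.ofReal_le_ofReal ha, fun z _ => h z⟩

/-- Two events whose probabilities sum to more than one have a common point. -/
theorem SampleHolds.exists_and {d n : ℕ} {P : Measure (Pair d)} [IsProbabilityMeasure P] {a b : ℝ}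
    {Φ Ψ : (Fin n → Pair d) → Prop} (h : SampleHolds P n a Φ) (h' : SampleHolds P n b Ψ)
    (hab : 1 < a + b) : ∃ z, Φ z ∧ Ψ z := by
  obtain ⟨A, -, hPA, hA⟩ := h
  obtain ⟨B, hB, hPB, hz⟩ := h'
  by_contra hne
  push Not at hne
  have hd : Disjoint A B := Set.disjoint_left.2 fun z h1 h2 => hne z (hA z h1) (hz z h2)
  have h1 := prob_le_one (μ := Measure.pi fun _ : Fin n => P) (s := A ∪ B)
  rw [measure_union hd hB] at h1
  have h2 : ENNReal.ofReal (a + b) ≤ 1 :=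
    ENNReal.ofReal_add_le.trans ((add_le_add hPA hPB).trans h1)
  rw [ENNReal.ofReal_le_one] at h2
  linarith

/-- A subfamily of an independent family is independent. -/
theorem pi_map_comp_injective {α : Type*} [MeasurableSpace α] {m n : ℕ} {e : Fin m → Fin n}
    (he : Function.Injective e) (μ : Fin n → Measure α) [∀ i, IsProbabilityMeasure (μ i)]
    (P : Measure α) [IsProbabilityMeasure P] (hμ : ∀ j, μ (e j) = P) :
    (Measure.pi μ).map (fun z j => z (e j)) = Measure.pi fun _ : Fin m => P := by
  symm
  refine Measure.pi_eq fun s hs => ?_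
  rw [Measure.map_apply (by fun_prop) (MeasurableSet.univ_pi hs)]
  have : (fun (z : Fin n → α) j => z (e j)) ⁻¹' Set.univ.pi s =
      Set.univ.pi fun i => ⋂ (j) (_ : e j = i), s j := by
    ext z
    simp only [Set.mem_preimage, Set.mem_pi, Set.mem_univ, true_imp_iff, Set.mem_iInter]
    exact ⟨fun h i j hj => hj ▸ h j, fun h j => h _ j rfl⟩
  rw [this, Measure.pi_pi]
  symm
  -- Coordinates outside the range of `e` are unconstrained and contribute a factor 1.
  refine Fintype.prod_of_injective e he _ _ (fun i hi => ?_) fun j => ?_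
  · have : ⋂ (j) (_ : e j = i), s j = Set.univ := by
      refine Set.iInter_eq_univ.2 fun j => Set.iInter_eq_univ.2 fun h => absurd ⟨j, h⟩ hi
    rw [this, measure_univ]
  · rw [hμ]
    congr 1
    ext x
    simp [he.eq_iff]

theorem pi_smul_eq_prod_smul {α : Type*} [MeasurableSpace α] {n : ℕ} (w : Fin n → ℝ)
    (μ : Fin n → Measure α) [∀ i, IsProbabilityMeasure (μ i)] :
    Measure.pi (fun i => ENNReal.ofReal (w i) • μ i) =
      (∏ i, ENNReal.ofReal (w i)) • Measure.pi μ := by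
  have : ∀ i, IsFiniteMeasure (ENNReal.ofReal (w i) • μ i) := fun i =>
    Measure.smul_finite _ ENNReal.ofReal_ne_top
  refine Measure.pi_eq fun s _ => ?_
  simp [Measure.pi_pi, Finset.prod_mul_distrib]

/-- The probability that exactly the observations indexed by `S` are not censored, and that they
form a sample in `A`. -/
theorem pi_censored_support {d n : ℕ} (P : Measure (Pair d)) [IsProbabilityMeasure P]
    (h0 : P {0} = 0) (p : unitInterval) (S : Finset (Fin n)) {A : Set (Fin S.card → Pair d)}
    (hA : MeasurableSet A) :
    Measure.pi (fun _ : Fin n => censored P p)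
      ({z | ∀ i, z i ≠ 0 ↔ i ∈ S} ∩ (fun z j => z (S.orderEmbOfFin rfl j)) ⁻¹' A) =
      ENNReal.ofReal ((p : ℝ) ^ S.card * (1 - p) ^ (n - S.card)) *
        Measure.pi (fun _ : Fin S.card => P) A := by
  classical
  have hp1 : (0 : ℝ) ≤ 1 - p := by linarith [p.2.2]
  -- On the event that S is the set of non-null observations, the product law splits by coordinate:
  -- p P on S, and (1 - p) times the Dirac mass at 0 off S.
  set s : Fin n → Set (Pair d) := fun i => if i ∈ S then {0}ᶜ else {0} with hs
  set w : Fin n → ℝ := fun i => if i ∈ S then p else 1 - p with hw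
  set μ : Fin n → Measure (Pair d) := fun i => if i ∈ S then P else Measure.dirac 0 with hμ
  have : ∀ i, IsProbabilityMeasure (μ i) := fun i => by
    simp only [hμ]; split_ifs <;> infer_instance
  have hset : {z : Fin n → Pair d | ∀ i, z i ≠ 0 ↔ i ∈ S} = Set.univ.pi s := by
    ext z
    simp only [Set.mem_ofPred_eq, Set.mem_pi, Set.mem_univ, true_imp_iff, hs]
    refine forall_congr' fun i => ?_
    by_cases hi : i ∈ S <;> simp [hi]
  have hrestr : ∀ i, (censored P p).restrict (s i) = ENNReal.ofReal (w i) • μ i := fun i => by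
    simp only [hs, hw, hμ]
    rw [censored_eq, Measure.restrict_add, Measure.restrict_smul, Measure.restrict_smul]
    by_cases hi : i ∈ S
    · have h1 : P.restrict {0}ᶜ = P := Measure.restrict_eq_self_of_ae_mem
        (measure_mono_null (by intro z; simp) h0)
      have h2 : (Measure.dirac (0 : Pair d)).restrict {0}ᶜ = 0 := by
        rw [Measure.restrict_eq_zero]; simp
      simp [hi, h1, h2]
    · have h1 : P.restrict {0} = 0 := Measure.restrict_eq_zero.2 h0
      have h2 : (Measure.dirac (0 : Pair d)).restrict {0} = Measure.dirac 0 :=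
        Measure.restrict_eq_self_of_ae_mem (by simp [ae_dirac_eq])
      simp [hi, h1, h2]
  have hmeas : Measurable fun (z : Fin n → Pair d) j => z (S.orderEmbOfFin rfl j) := by fun_prop
  rw [hset, Set.inter_comm, ← Measure.restrict_apply (hmeas hA), Measure.restrict_pi_pi]
  rw [funext hrestr]
  rw [pi_smul_eq_prod_smul, Measure.smul_apply, smul_eq_mul, ← Measure.map_apply hmeas hA,
    pi_map_comp_injective (S.orderEmbOfFin rfl).injective μ P
      (fun j => by simp [hμ]), ← ENNReal.ofReal_prod_of_nonneg
      (fun i _ => by simp only [hw]; split_ifs; exacts [p.2.1, hp1])]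
  congr 2
  simp only [hw]
  rw [Finset.prod_ite]
  simp [Finset.filter_not, ← Finset.compl_eq_univ_sdiff, Finset.card_compl]

/-- The probability that the number of uncensored observations belongs to `M`. -/
noncomputable def binomialMass (n : ℕ) (p : ℝ) (M : Set ℕ) : ℝ :=
  open Classical in
  ∑ S : Finset (Fin n) with S.card ∈ M, p ^ S.card * (1 - p) ^ (n - S.card)

/-- Conditionally on the number `m` of uncensored observations, they form a sample of size `m` of
the uncensored law. -/
theorem SampleHolds.censored {d n : ℕ} {P : Measure (Pair d)} [IsProbabilityMeasure P]
    (h0 : P {0} = 0) (p : unitInterval) {M : Set ℕ} {a : ℝ}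
    {Φ : ∀ m, (Fin m → Pair d) → Prop} (h : ∀ m ∈ M, SampleHolds P m a (Φ m)) :
    SampleHolds (_root_.censored P p) n (a * binomialMass n p M) (fun z =>
      ∃ S : Finset (Fin n), S.card ∈ M ∧ (∀ i ∉ S, z i = 0) ∧
        Φ S.card fun j => z (S.orderEmbOfFin rfl j)) := by
  classical
  choose! A hA hPA hAΦ using h
  have hp1 : (0 : ℝ) ≤ 1 - p := by linarith [p.2.2]
  set T : Finset (Finset (Fin n)) := Finset.univ.filter fun S => S.card ∈ M with hT
  have hTM : ∀ S ∈ T, S.card ∈ M := fun S hS => (Finset.mem_filter.1 hS).2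
  -- These events are pairwise disjoint because a sample determines the set S of its non-null
  -- observations. The probabilities therefore add up to the binomial mass.
  set E : Finset (Fin n) → Set (Fin n → Pair d) := fun S =>
    {z | ∀ i, z i ≠ 0 ↔ i ∈ S} ∩ (fun z j => z (S.orderEmbOfFin rfl j)) ⁻¹' A S.card with hE
  have hEm : ∀ S ∈ T, MeasurableSet (E S) := fun S hS => by
    have hmeas : Measurable fun (z : Fin n → Pair d) j => z (S.orderEmbOfFin rfl j) := by fun_prop
    refine MeasurableSet.inter ?_ (hmeas (hA _ (hTM S hS)))
    have : {z : Fin n → Pair d | ∀ i, z i ≠ 0 ↔ i ∈ S} = ⋂ i, {z | z i ≠ 0 ↔ i ∈ S} := by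
      ext; simp
    rw [this]
    refine MeasurableSet.iInter fun i => ?_
    have hm : MeasurableSet {z : Fin n → Pair d | z i = 0} :=
      (measurableSet_singleton (0 : Pair d)).preimage (measurable_pi_apply i)
    by_cases hi : i ∈ S
    · simp only [hi, iff_true]
      exact hm.compl
    · simpa only [hi, iff_false, not_not] using hm
  refine ⟨⋃ S ∈ T, E S, Finset.measurableSet_biUnion T hEm, ?_, ?_⟩
  · rw [measure_biUnion_finset ?_ hEm]
    · have hT' : binomialMass n p M = ∑ S ∈ T, (p : ℝ) ^ S.card * (1 - p) ^ (n - S.card) := by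
        rw [binomialMass, hT]
      have hnn : ∀ S ∈ T, 0 ≤ (p : ℝ) ^ S.card * (1 - p) ^ (n - S.card) := fun S _ =>
        mul_nonneg (pow_nonneg p.2.1 _) (pow_nonneg hp1 _)
      rw [hT', mul_comm, ENNReal.ofReal_mul (Finset.sum_nonneg hnn),
        ENNReal.ofReal_sum_of_nonneg hnn, Finset.sum_mul]
      refine Finset.sum_le_sum fun S hS => ?_
      rw [hE, pi_censored_support P h0 p S (hA _ (hTM S hS))]
      gcongr
      exact hPA _ (hTM S hS)
    · intro S _ S' _ hne
      refine Set.disjoint_left.2 fun z hz hz' => hne ?_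
      ext i
      rw [← hz.1 i, ← hz'.1 i]
  · intro z hz
    simp only [Set.mem_iUnion] at hz
    obtain ⟨S, hS, hz⟩ := hz
    refine ⟨S, hTM S hS, fun i hi => ?_, hAΦ _ (hTM S hS) _ hz.2⟩
    by_contra hne
    exact hi ((hz.1 i).1 hne)

/-- The number of uncensored observations is between `np / 4` and `Knp`. -/
theorem binomialMass_ge {n : ℕ} {p K ε : ℝ} (hp : p ∈ Set.Icc (0 : ℝ) 1) (hε : ε ∈ Set.Ioo (0 : ℝ) 1)
    (hK : 1 ≤ K) (h1 : 8 * Real.log ε⁻¹ ≤ n * p)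
    (h2 : Real.log ε⁻¹ ≤ n * p * (K * Real.log K - K + 1)) :
    1 - 2 * ε ≤ binomialMass n p {m | n * p / 4 ≤ m ∧ (m : ℝ) ≤ K * (n * p)} := by
  classical
  have hp1 : 0 ≤ 1 - p := by linarith [hp.2]
  have hK0 : 0 < K := by linarith
  set w : Finset (Fin n) → ℝ := fun S => p ^ S.card * (1 - p) ^ (n - S.card) with hw
  have hw0 : ∀ S, 0 ≤ w S := fun S => mul_nonneg (pow_nonneg hp.1 _) (pow_nonneg hp1 _)
  have hgen : ∀ x : ℝ, ∑ S, w S * x ^ S.card = (1 + p * (x - 1)) ^ n := fun x => by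
    have := Fintype.sum_pow_mul_eq_add_pow (Fin n) (p * x) (1 - p)
    rw [Fintype.card_fin] at this
    rw [show 1 + p * (x - 1) = p * x + (1 - p) by ring, ← this]
    refine Finset.sum_congr rfl fun S _ => ?_
    rw [hw, mul_pow]; ring
  have htot : ∑ S, w S = 1 := by simpa using hgen 1
  set M : Set ℕ := {m | n * p / 4 ≤ m ∧ (m : ℝ) ≤ K * (n * p)} with hM
  have hsplit : binomialMass n p M = 1 - ∑ S with S.card ∉ M, w S := by
    rw [← htot, ← Finset.sum_filter_add_sum_filter_not Finset.univ (fun S => S.card ∈ M) w,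
      binomialMass]
    simp only [add_sub_cancel_right]
    congr!
  have hexp : ∀ x : ℝ, 0 ≤ 1 + p * (x - 1) → (1 + p * (x - 1)) ^ n ≤ Real.exp (n * p * (x - 1)) :=
    fun x hx => by
      rw [show n * p * (x - 1) = n * (p * (x - 1)) by ring, Real.exp_nat_mul]
      exact pow_le_pow_left₀ hx (by linarith [Real.add_one_le_exp (p * (x - 1))]) n
  have hlogK : 0 ≤ Real.log K := Real.log_nonneg hK
  have hεL : ∀ y, Real.log ε⁻¹ ≤ y → Real.exp (-y) ≤ ε := fun y hy => by
    rw [← Real.le_log_iff_exp_le hε.1]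
    rw [Real.log_inv] at hy
    linarith
  -- Two-sided Chernoff bound: whenever the size of S leaves the interval, one of the two
  -- exponential weights, with bases K and 1/4, is at least 1.
  have hbad : ∑ S with S.card ∉ M, w S ≤
      ∑ S, (Real.exp (-(K * (n * p) * Real.log K)) * (w S * K ^ S.card) +
        Real.exp (n * p / 4 * Real.log 4) * (w S * (1 / 4) ^ S.card)) := by
    refine le_trans (Finset.sum_le_sum fun S hS => ?_)
      (Finset.sum_le_sum_of_subset_of_nonneg (Finset.filter_subset _ _) fun S _ _ =>
        add_nonneg (mul_nonneg (Real.exp_pos _).le (mul_nonneg (hw0 S) (by positivity)))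
          (mul_nonneg (Real.exp_pos _).le (mul_nonneg (hw0 S) (by positivity))))
    have hS' : S.card ∉ M := (Finset.mem_filter.1 hS).2
    have e1 : K ^ S.card = Real.exp (S.card * Real.log K) := by
      rw [Real.exp_nat_mul, Real.exp_log hK0]
    have e2 : (1 / 4 : ℝ) ^ S.card = Real.exp (-(S.card * Real.log 4)) := by
      rw [Real.exp_neg, Real.exp_nat_mul, Real.exp_log (by norm_num)]; simp
    have f1 : Real.exp (-(K * (n * p) * Real.log K)) * (w S * K ^ S.card) =
        w S * Real.exp ((S.card - K * (n * p)) * Real.log K) := by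
      rw [e1, mul_left_comm, ← Real.exp_add]; ring_nf
    have f2 : Real.exp (n * p / 4 * Real.log 4) * (w S * (1 / 4) ^ S.card) =
        w S * Real.exp ((n * p / 4 - S.card) * Real.log 4) := by
      rw [e2, mul_left_comm, ← Real.exp_add]; ring_nf
    rw [f1, f2, ← mul_add]
    refine le_mul_of_one_le_right (hw0 S) ?_
    have g1 := Real.exp_pos ((S.card - K * (n * p)) * Real.log K)
    have g2 := Real.exp_pos ((n * p / 4 - S.card) * Real.log 4)
    rcases le_or_gt (n * p / 4) (S.card : ℝ) with h | h
    · have h' : K * (n * p) < S.card := by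
        by_contra hc; exact hS' ⟨h, not_lt.1 hc⟩
      have := Real.one_le_exp (mul_nonneg (sub_nonneg.2 h'.le) hlogK)
      linarith
    · have := Real.one_le_exp (mul_nonneg (sub_nonneg.2 h.le) (Real.log_nonneg (by norm_num :
        (1 : ℝ) ≤ 4)))
      linarith
  rw [Finset.sum_add_distrib, ← Finset.mul_sum, ← Finset.mul_sum, hgen, hgen] at hbad
  have b1 : Real.exp (-(K * (n * p) * Real.log K)) * (1 + p * (K - 1)) ^ n ≤ ε := by
    refine le_trans (mul_le_mul_of_nonneg_left (hexp K ?_) (Real.exp_pos _).le) ?_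
    · nlinarith [hp.1]
    · rw [← Real.exp_add]
      refine le_trans (le_of_eq ?_) (hεL _ h2)
      ring_nf
  have b2 : Real.exp (n * p / 4 * Real.log 4) * (1 + p * (1 / 4 - 1)) ^ n ≤ ε := by
    have hl4 : Real.log 4 ≤ 1.4 := by
      rw [show (4 : ℝ) = 2 ^ 2 by norm_num, Real.log_pow]
      have := Real.log_two_lt_d9
      push_cast; linarith
    have hL : 0 ≤ Real.log ε⁻¹ := Real.log_nonneg ((one_le_inv₀ hε.1).2 hε.2.le)
    refine le_trans (mul_le_mul_of_nonneg_left (hexp (1 / 4) ?_) (Real.exp_pos _).le) ?_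
    · linarith [hp.2]
    · rw [← Real.exp_add]
      -- The exponent is np (log 4 / 4 - 3/4), at most np (0.35 - 0.75) = -0.4 np.
      refine le_trans (Real.exp_le_exp.2 ?_) (hεL (n * p * 0.4) (by linarith))
      nlinarith
  rw [hsplit]
  linarith

/-- Censored observations do not enter the empirical risk. -/
theorem IsERM.restrict {d n : ℕ} {z : Fin n → Pair d} {θ : Vec d} (h : IsERM z θ)
    {S : Finset (Fin n)} (hS : ∀ i ∉ S, z i = 0) :
    IsERM (fun j => z (S.orderEmbOfFin rfl j)) θ := by
  have key : ∀ θ : Vec d, ∑ j, ((z (S.orderEmbOfFin rfl j)).2 -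
      inner ℝ θ (z (S.orderEmbOfFin rfl j)).1) ^ 2 = ∑ i, ((z i).2 - inner ℝ θ (z i).1) ^ 2 :=
    fun θ => Fintype.sum_of_injective (S.orderEmbOfFin rfl) (S.orderEmbOfFin rfl).injective _ _
      (fun i hi => by
        have : i ∉ S := by simpa using hi
        simp [hS i this]) fun _ => rfl
  intro θ'
  rw [key, key]
  exact h θ'

/-- The lower bound on the excess risk of empirical risk minimizers for censored samples. -/
theorem excess_risk_lower_bound_censored {d : ℕ} {Q : Measure (Vec d)} [IsProbabilityMeasure Q]
    (hQ : MemLp (fun x : Vec d => x) 2 Q) (hG : (gram Q).rank = d) (θs : Vec d) {σ ε δ K : ℝ}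
    (hσ : 0 < σ) (hε : ε ∈ Set.Ioo (0 : ℝ) (1 / 2)) (hδ : δ ∈ Set.Ioo (0 : ℝ) 1)
    (p : unitInterval) {n : ℕ} (hK : 1 ≤ K) (h1 : 8 * Real.log ε⁻¹ ≤ n * p)
    (h2 : Real.log ε⁻¹ ≤ n * p * (K * Real.log K - K + 1))
    (h : ∀ m : ℕ, n * (p : ℝ) / 4 ≤ m → SampleHolds (linearModel Q θs σ) m (1 - 2 * ε)
      (fun z => GramDevLe (linearModel Q θs σ) δ z)) :
    SampleHolds (censored (linearModel Q θs σ) p) n (1 - 5 * ε) (fun z => ∀ θ, IsERM z θ →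
      (d * Real.log 2 - 2 * Real.log ε⁻¹) * σ ^ 2 / ((1 + δ) * K * n) ≤
        risk (censored (linearModel Q θs σ) p) θ - risk (censored (linearModel Q θs σ) p) θs) := by
  set P := linearModel Q θs σ with hP
  have hε1 : 1 < ε⁻¹ := (one_lt_inv₀ hε.1).2 (by linarith [hε.2])
  have hL : 0 < Real.log ε⁻¹ := Real.log_pos hε1
  have hp : 0 ≤ (p : ℝ) := p.2.1
  have hnp : 0 < n * (p : ℝ) := by linarith
  set M : Set ℕ := {m | n * (p : ℝ) / 4 ≤ m ∧ (m : ℝ) ≤ K * (n * p)} with hM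
  have hmpos : ∀ m ∈ M, 0 < m := fun m hm => by
    have : (0 : ℝ) < m := lt_of_lt_of_le (by linarith) hm.1
    exact_mod_cast this
  have hmass : 1 - 2 * ε ≤ binomialMass n p M :=
    binomialMass_ge p.2 ⟨hε.1, by linarith [hε.2]⟩ hK h1 h2
  have hS := SampleHolds.censored (n := n) (linearModel_singleton_zero θs σ hσ) p fun m hm =>
    excess_risk_lower_bound hQ hG θs hσ hε.1 hδ (hmpos m hm) (h m hm.1)
  have hδ1 : 0 < 1 + δ := by linarith [hδ.1]
  have hK0 : 0 < K := by linarith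
  have hrisk : ∀ θ, risk (censored P p) θ - risk (censored P p) θs =
      p * (risk P θ - risk P θs) := fun θ => by
    rw [risk_censored P p θ (integrable_residual_sq θs σ hQ θ),
      risk_censored P p θs (integrable_residual_sq θs σ hQ θs), mul_sub]
  have hmin : ∀ θ, 0 ≤ risk P θ - risk P θs := fun θ => by
    rw [hP, risk_linearModel θs σ hQ, risk_linearModel θs σ hQ, sub_self, energy_zero]
    linarith [energy_nonneg (linearModel Q θs σ) (θ - θs)]
  -- If 1 - 3ε is negative, so is 1 - 5ε, and the empty event suffices. Otherwise (1 - 3ε)(1 - 2ε) ≥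
  -- 1 - 5ε.
  rcases lt_or_ge (1 - 3 * ε) 0 with h3 | h3
  · refine ⟨∅, MeasurableSet.empty, ?_, fun z hz => absurd hz (Set.notMem_empty z)⟩
    rw [ENNReal.ofReal_of_nonpos (by linarith [hε.1])]
    exact zero_le
  refine hS.mono ?_ ?_
  · nlinarith [mul_le_mul_of_nonneg_left hmass h3, hε.1]
  · rintro z ⟨S, hSM, hS0, hz⟩ θ hθ
    have hb := hz θ (hθ.restrict hS0)
    have hm : (0 : ℝ) < S.card := by exact_mod_cast hmpos _ hSM
    have hn : (0 : ℝ) < n := by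
      rcases (Nat.cast_nonneg n : (0 : ℝ) ≤ n).eq_or_lt with h | h
      · rw [← h] at hnp; simp at hnp
      · exact h
    rw [hrisk]
    set c := (d * Real.log 2 - 2 * Real.log ε⁻¹) * σ ^ 2 with hc
    -- The upper bound m ≤ K n p on the denominator helps only when c > 0. For c ≤ 0 the claim
    -- follows from the minimality of `θs`.
    rcases le_or_gt c 0 with hc0 | hc0
    · exact le_trans (div_nonpos_of_nonpos_of_nonneg hc0 (by positivity))
        (mul_nonneg hp (hmin θ))
    · refine le_trans ?_ (mul_le_mul_of_nonneg_left hb hp)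
      rw [← mul_div_assoc, div_le_div_iff₀ (by positivity) (by positivity)]
      have := mul_le_mul_of_nonneg_left hSM.2 (mul_pos hc0 hδ1).le
      linarith

/-! ### Concentration of the squares of Gaussian variables -/

/-- Taylor expansion to order 3 with remainder |x|⁴ / (1 - |x|). For |x| ≤ 4/9 the coefficient of x²
is at most 1/2 + 4/27 + 16/45 < 1.004. -/
theorem neg_log_one_sub_le {x : ℝ} (hx : |x| ≤ 4 / 9) :
    -Real.log (1 - x) ≤ x + 1.004 * x ^ 2 := by
  have h := Real.abs_log_sub_add_sum_range_le (x := x) (by linarith) 3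
  simp only [Finset.sum_range_succ, Finset.sum_range_zero] at h
  norm_num at h
  have h1 := (abs_le.1 h).1
  have hsq : |x| ^ 2 = x ^ 2 := sq_abs x
  have h0 := abs_nonneg x
  have h2 : |x| ^ 4 / (1 - |x|) ≤ 16 / 45 * x ^ 2 := by
    rw [div_le_iff₀ (by linarith), ← hsq]
    have : |x| ^ 2 ≤ 16 / 45 * (1 - |x|) := by nlinarith
    nlinarith [sq_nonneg |x|]
  have h3 : x ^ 3 ≤ 4 / 9 * x ^ 2 := by nlinarith [sq_nonneg x, le_abs_self x]
  nlinarith [sq_nonneg x]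

/-- A normalized squared Gaussian variable, centred or not, is sub-exponential. -/
theorem lintegral_exp_sq_sub_one_le {m : ℝ} {v : ℝ≥0} (hmv : m ^ 2 + v = 1) {t : ℝ}
    (ht : |t| ≤ 2 / 9) :
    ∫⁻ x, ENNReal.ofReal (Real.exp (t * (x ^ 2 - 1))) ∂(gaussianReal m v) ≤
      ENNReal.ofReal (Real.exp (2.01 * t ^ 2)) := by
  have hv0 : (0 : ℝ) ≤ v := v.2
  have hv1 : (v : ℝ) ≤ 1 := by nlinarith [sq_nonneg m]
  have hx : |2 * t * v| ≤ 4 / 9 := by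
    rw [abs_mul, abs_mul, abs_of_nonneg hv0, abs_two]
    nlinarith [abs_nonneg t]
  have hx' := abs_le.1 hx
  have hr : 0 < 1 - 2 * t * v := by linarith [hx'.2]
  have hsplit : ∀ x : ℝ, ENNReal.ofReal (Real.exp (t * (x ^ 2 - 1))) =
      ENNReal.ofReal (Real.exp (-t)) * ENNReal.ofReal (Real.exp (t * x ^ 2)) := fun x => by
    rw [← ENNReal.ofReal_mul (Real.exp_pos _).le, ← Real.exp_add]; ring_nf
  simp_rw [hsplit]
  rw [lintegral_const_mul _ (by fun_prop), lintegral_exp_mul_sq_gaussianReal m v (by linarith),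
    ← ENNReal.ofReal_mul (Real.exp_pos _).le]
  refine ENNReal.ofReal_le_ofReal ?_
  have hs : (√(1 - 2 * t * v))⁻¹ = Real.exp (-Real.log (1 - 2 * t * v) / 2) := by
    rw [neg_div, Real.exp_neg, Real.sqrt_eq_rpow, Real.rpow_def_of_pos hr]
    congr 2; ring
  rw [hs, ← Real.exp_add, ← Real.exp_add]
  refine Real.exp_le_exp.2 ?_
  have hlog := neg_log_one_sub_le hx
  have hm : m ^ 2 = 1 - v := by linarith
  -- The denominator is at least 5/9, whence 2 / (5/9) = 3.6. The linear terms tv and t(1 - v)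
  -- cancel the centring -t.
  have hfrac : t * m ^ 2 / (1 - 2 * t * v) ≤ t * (1 - v) + 3.6 * (t ^ 2 * (v * (1 - v))) := by
    have h1 : t * m ^ 2 / (1 - 2 * t * v) =
        t * (1 - v) + 2 * (t ^ 2 * (v * (1 - v))) / (1 - 2 * t * v) := by
      have hne : 1 - 2 * t * v ≠ 0 := hr.ne'
      rw [hm, div_eq_iff hne, add_mul, div_mul_cancel₀ _ hne]
      ring
    rw [h1]
    have h0 : 0 ≤ t ^ 2 * (v * (1 - v)) :=
      mul_nonneg (sq_nonneg t) (mul_nonneg hv0 (by linarith))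
    have : 2 * (t ^ 2 * (v * (1 - v))) / (1 - 2 * t * v) ≤ 3.6 * (t ^ 2 * (v * (1 - v))) := by
      rw [div_le_iff₀ hr]
      nlinarith [hx'.2]
    linarith
  -- The left side 3.6 v - 1.592 v² increases on [0, 1], so the centred case v = 1 is the worst,
  -- with value 2.008.
  have hquad : 2.008 * (v : ℝ) ^ 2 + 3.6 * (v * (1 - v)) ≤ 2.01 := by nlinarith
  have := mul_le_mul_of_nonneg_left hquad (sq_nonneg t)
  nlinarith

/-- Chernoff's bound at t = ± s/4, admissible since s ≤ 8/9. The rate is s²/4 - 2.01 s²/16 ≥ 0.124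
s². -/
theorem measure_pi_abs_sum_sq_sub_one_ge {α : Type*} [MeasurableSpace α] (P : Measure α)
    [IsProbabilityMeasure P] {W : α → ℝ} (hW : Measurable W) {m : ℝ} {v : ℝ≥0}
    (hlaw : P.map W = gaussianReal m v) (hmv : m ^ 2 + v = 1) (n : ℕ) {s : ℝ}
    (hs : s ∈ Set.Icc (0 : ℝ) (8 / 9)) :
    Measure.pi (fun _ : Fin n => P) {z | n * s ≤ |∑ i, (W (z i) ^ 2 - 1)|} ≤
      2 * ENNReal.ofReal (Real.exp (-(n * (0.124 * s ^ 2)))) := by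
  have htail : ∀ t : ℝ, |t| = s / 4 →
      Measure.pi (fun _ : Fin n => P) {z | s / 4 * (n * s) ≤ ∑ i, t * (W (z i) ^ 2 - 1)} ≤
        ENNReal.ofReal (Real.exp (-(n * (0.124 * s ^ 2)))) := fun t ht => by
    have ht2 : t ^ 2 = s ^ 2 / 16 := by rw [← sq_abs, ht]; ring
    refine (measure_pi_le_sum_le P n (φ := fun x => t * (W x ^ 2 - 1)) (by fun_prop) _).trans ?_
    have h1 : ∫⁻ x, ENNReal.ofReal (Real.exp (t * (W x ^ 2 - 1))) ∂P ≤
        ENNReal.ofReal (Real.exp (2.01 * t ^ 2)) := by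
      have := lintegral_exp_sq_sub_one_le hmv (t := t) (by rw [ht]; linarith [hs.2])
      rwa [← hlaw, lintegral_map (by fun_prop) hW] at this
    refine (mul_le_mul_right (pow_le_pow_left₀ zero_le h1 n) _).trans ?_
    rw [← ENNReal.ofReal_pow (Real.exp_pos _).le, ← Real.exp_nat_mul,
      ← ENNReal.ofReal_mul (Real.exp_pos _).le, ← Real.exp_add]
    refine ENNReal.ofReal_le_ofReal (Real.exp_le_exp.2 ?_)
    rw [ht2]
    have : 0 ≤ (n : ℝ) * s ^ 2 := by positivity
    nlinarith
  have hs4 : 0 ≤ s / 4 := by linarith [hs.1]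
  rw [two_mul]
  refine le_trans (measure_mono ?_) ((measure_union_le _ _).trans
    (add_le_add (htail (s / 4) (abs_of_nonneg hs4))
      (htail (-(s / 4)) (by rw [abs_neg, abs_of_nonneg hs4]))))
  intro z hz
  have hz' : n * s ≤ |∑ i, (W (z i) ^ 2 - 1)| := hz
  simp only [Set.mem_union, Set.mem_ofPred_eq, ← Finset.mul_sum]
  rcases le_abs.1 hz' with h | h
  · exact Or.inl (mul_le_mul_of_nonneg_left h hs4)
  · refine Or.inr ?_
    have := mul_le_mul_of_nonneg_left h hs4
    linarith

/-! ### Gaussian designs -/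

section GaussianDesign

variable {d : ℕ} {Q : Measure (Vec d)}

theorem exists_map_inner_eq_gaussianReal (hg : IsGaussian Q) (θ : Vec d) :
    ∃ v : ℝ≥0, Q.map (fun x => inner ℝ θ x) = gaussianReal (inner ℝ θ (∫ x, x ∂Q)) v ∧
      ∫ x, (inner ℝ θ x) ^ 2 ∂Q = (inner ℝ θ (∫ x, x ∂Q)) ^ 2 + v := by
  have h := IsGaussian.map_eq_gaussianReal (μ := Q) (innerSL ℝ θ)
  have hmean : ∫ x, innerSL ℝ θ x ∂Q = inner ℝ θ (∫ x, x ∂Q) :=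
    (innerSL ℝ θ).integral_comp_comm IsGaussian.integrable_id
  rw [hmean] at h
  refine ⟨_, h, ?_⟩
  rw [← integral_sq_gaussianReal, ← h, integral_map (by fun_prop) (by fun_prop)]
  rfl

theorem pi_linearModel_energy_deviation [IsProbabilityMeasure Q] (hg : IsGaussian Q)
    (hQ : MemLp (fun x : Vec d => x) 2 Q) (hG : (gram Q).rank = d) (θs : Vec d) (σ : ℝ)
    (θ : Vec d) (n : ℕ) {s : ℝ} (hs : s ∈ Set.Icc (0 : ℝ) (8 / 9)) :
    Measure.pi (fun _ : Fin n => linearModel Q θs σ)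
      {z | s * (n * ∫ x, (inner ℝ θ x) ^ 2 ∂Q) <
        |∑ i, (inner ℝ θ (z i).1) ^ 2 - n * ∫ x, (inner ℝ θ x) ^ 2 ∂Q|} ≤
      2 * ENNReal.ofReal (Real.exp (-(n * (0.124 * s ^ 2)))) := by
  rcases eq_or_ne θ 0 with rfl | hθ
  · simp
  have hE := energy_pos_of_rank_gram hQ hG hθ
  set E := ∫ x, (inner ℝ θ x) ^ 2 ∂Q with hEdef
  -- Relative deviations are scale-invariant, so the direction is normalized to unit energy, as the
  -- scalar bound requires.
  set θ' := (√E)⁻¹ • θ with hθ'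
  have hsq : (√E)⁻¹ ^ 2 = E⁻¹ := by rw [inv_pow, Real.sq_sqrt hE.le]
  have hin : ∀ x : Vec d, (inner ℝ θ' x) ^ 2 = E⁻¹ * (inner ℝ θ x) ^ 2 := fun x => by
    rw [hθ', inner_smul_left, mul_pow, ← hsq]; rfl
  obtain ⟨v, hlaw, hmv⟩ := exists_map_inner_eq_gaussianReal hg θ'
  have hE' : ∫ x, (inner ℝ θ' x) ^ 2 ∂Q = 1 := by
    simp_rw [hin]
    rw [integral_const_mul, ← hEdef, inv_mul_cancel₀ hE.ne']
  have hlaw' : (linearModel Q θs σ).map (fun z => inner ℝ θ' z.1) =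
      gaussianReal (inner ℝ θ' (∫ x, x ∂Q)) v := by
    rw [← hlaw, ← linearModel_map_fst Q θs σ, Measure.map_map (by fun_prop) (by fun_prop)]
    rw [linearModel_map_fst Q θs σ]
    rfl
  refine le_trans (measure_mono ?_) (measure_pi_abs_sum_sq_sub_one_ge (linearModel Q θs σ)
    (W := fun z => inner ℝ θ' z.1) (by fun_prop) hlaw' (by rw [← hmv, hE']) n hs)
  intro z hz
  have hz' : s * (n * E) < |∑ i, (inner ℝ θ (z i).1) ^ 2 - n * E| := hz
  have hsum : ∑ i, ((inner ℝ θ' (z i).1) ^ 2 - 1) =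
      E⁻¹ * (∑ i, (inner ℝ θ (z i).1) ^ 2 - n * E) := by
    simp_rw [hin]
    rw [Finset.sum_sub_distrib, ← Finset.mul_sum]
    simp only [Finset.sum_const, Finset.card_univ, Fintype.card_fin, nsmul_eq_mul, mul_one]
    field_simp
  change n * s ≤ |∑ i, ((inner ℝ θ' (z i).1) ^ 2 - 1)|
  rw [hsum, abs_mul, abs_of_pos (inv_pos.2 hE), inv_mul_eq_div, le_div_iff₀ hE]
  linarith

/-- The bilinear form of the Gram matrix. -/
noncomputable def energyForm (hQ : MemLp (fun x : Vec d => x) 2 Q) :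
    LinearMap.BilinForm ℝ (Vec d) :=
  LinearMap.mk₂ ℝ (fun θ θ' => ∫ x, inner ℝ θ x * inner ℝ θ' x ∂Q)
    (fun a b c => by
      simp_rw [inner_add_left, add_mul]
      exact integral_add (integrable_inner_mul_inner hQ a c) (integrable_inner_mul_inner hQ b c))
    (fun r a b => by
      simp_rw [inner_smul_left, mul_assoc]
      exact integral_const_mul _ _)
    (fun a b c => by
      simp_rw [inner_add_left, mul_add]
      exact integral_add (integrable_inner_mul_inner hQ a b) (integrable_inner_mul_inner hQ a c))
    (fun r a b => by
      simp_rw [inner_smul_left, mul_left_comm]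
      exact integral_const_mul _ _)

theorem energyForm_self (hQ : MemLp (fun x : Vec d => x) 2 Q) (θ : Vec d) :
    energyForm hQ θ θ = ∫ x, (inner ℝ θ x) ^ 2 ∂Q := by
  simp [energyForm, sq]

theorem energyForm_comm (hQ : MemLp (fun x : Vec d => x) 2 Q) (θ θ' : Vec d) :
    energyForm hQ θ θ' = energyForm hQ θ' θ := by
  simp [energyForm, mul_comm]

/-- A basis of `ℝ^d` which is orthonormal for the Gram matrix. -/
theorem exists_energyForm_orthonormal (hQ : MemLp (fun x : Vec d => x) 2 Q)
    (hG : (gram Q).rank = d) :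
    ∃ u : Fin d → Vec d, (∀ i j, energyForm hQ (u i) (u j) = if i = j then 1 else 0) ∧
      ∀ θ, ∃ c : Fin d → ℝ, θ = ∑ i, c i • u i := by
  have hsymm : LinearMap.IsSymm (energyForm hQ) := ⟨fun x y => energyForm_comm hQ x y⟩
  obtain ⟨b₀, hb₀⟩ := LinearMap.BilinForm.exists_orthogonal_basis hsymm
  have hd : Module.finrank ℝ (Vec d) = d := by simp
  set b := b₀.reindex (finCongr hd) with hb
  have hort : ∀ i j, i ≠ j → energyForm hQ (b i) (b j) = 0 := fun i j hij => by
    simp only [hb, Module.Basis.reindex_apply]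
    exact LinearMap.isOrthoᵢ_def.1 hb₀ _ _ (by simpa using hij)
  have hpos : ∀ i, 0 < energyForm hQ (b i) (b i) := fun i => by
    rw [energyForm_self]
    exact energy_pos_of_rank_gram hQ hG (b.ne_zero i)
  refine ⟨fun i => (√(energyForm hQ (b i) (b i)))⁻¹ • b i, fun i j => ?_, fun θ =>
    ⟨fun i => √(energyForm hQ (b i) (b i)) * b.repr θ i, ?_⟩⟩
  · simp only [map_smul, LinearMap.smul_apply, smul_eq_mul]
    split_ifs with hij
    · subst hij
      have h1 := Real.mul_self_sqrt (hpos i).le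
      have h2 := (Real.sqrt_pos.2 (hpos i)).ne'
      rw [← mul_assoc, ← mul_inv, h1, inv_mul_cancel₀ (hpos i).ne']
    · rw [hort i j hij]; simp
  · conv_lhs => rw [← b.sum_repr θ]
    refine Finset.sum_congr rfl fun i _ => ?_
    rw [smul_smul]
    congr 1
    have h2 := (Real.sqrt_pos.2 (hpos i)).ne'
    field_simp

/-- Entries bounded by r give the bound r (∑ |cᵢ|)², and Cauchy–Schwarz costs a factor d. This loss
explains why each direction will be controlled at level 8 / (9d). -/
theorem abs_bilinForm_sum_le {V : Type*} [AddCommGroup V] [Module ℝ V]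
    (D : LinearMap.BilinForm ℝ V) (u : Fin d → V) {r : ℝ} (hr : ∀ i j, |D (u i) (u j)| ≤ r)
    (c : Fin d → ℝ) :
    |D (∑ i, c i • u i) (∑ i, c i • u i)| ≤ r * (d * ∑ i, c i ^ 2) := by
  have hexp : D (∑ i, c i • u i) (∑ i, c i • u i) = ∑ i, ∑ j, c i * c j * D (u i) (u j) := by
    simp only [map_sum, LinearMap.sum_apply, map_smul, LinearMap.smul_apply, smul_eq_mul]
    simp_rw [Finset.mul_sum]
    rw [Finset.sum_comm]
    refine Finset.sum_congr rfl fun i _ => ?_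
    exact Finset.sum_congr rfl fun j _ => by ring
  rcases Nat.eq_zero_or_pos d with rfl | hd
  · simp
  have hr0 : 0 ≤ r := (abs_nonneg _).trans (hr ⟨0, hd⟩ ⟨0, hd⟩)
  have h1 : ∀ i j, |c i * c j * D (u i) (u j)| ≤ |c i| * |c j| * r := fun i j => by
    rw [abs_mul, abs_mul]
    exact mul_le_mul_of_nonneg_left (hr i j) (by positivity)
  have hcs : (∑ i, |c i|) ^ 2 ≤ d * ∑ i, c i ^ 2 := by
    simpa using sq_sum_le_card_mul_sum_sq (s := Finset.univ) (f := fun i => |c i|)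
  calc |D (∑ i, c i • u i) (∑ i, c i • u i)|
      ≤ ∑ i, ∑ j, |c i| * |c j| * r := by
        rw [hexp]
        exact (Finset.abs_sum_le_sum_abs _ _).trans (Finset.sum_le_sum fun i _ =>
          (Finset.abs_sum_le_sum_abs _ _).trans (Finset.sum_le_sum fun j _ => h1 i j))
    _ = r * (∑ i, |c i|) ^ 2 := by
        simp_rw [← Finset.sum_mul]
        rw [sq, Finset.sum_mul_sum, mul_comm]
    _ ≤ _ := mul_le_mul_of_nonneg_left hcs hr0

/-- The deviations of the empirical energy in all directions are controlled by its deviations in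
the directions `u i ± u j`, where `u` is orthonormal for the Gram matrix. -/
theorem abs_sum_sq_sub_energy_le (hQ : MemLp (fun x : Vec d => x) 2 Q) {u : Fin d → Vec d}
    (hu : ∀ i j, energyForm hQ (u i) (u j) = if i = j then 1 else 0) {n : ℕ} (x : Fin n → Vec d)
    {s : ℝ} (hx : ∀ i j, ∀ w ∈ ({u i + u j, u i - u j} : Set (Vec d)),
      |∑ k, (inner ℝ w (x k)) ^ 2 - n * ∫ y, (inner ℝ w y) ^ 2 ∂Q| ≤
        s * (n * ∫ y, (inner ℝ w y) ^ 2 ∂Q)) (c : Fin d → ℝ) :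
    |∑ k, (inner ℝ (∑ i, c i • u i) (x k)) ^ 2 -
        n * ∫ y, (inner ℝ (∑ i, c i • u i) y) ^ 2 ∂Q| ≤
      s * d * (n * ∫ y, (inner ℝ (∑ i, c i • u i) y) ^ 2 ∂Q) := by
  let D : LinearMap.BilinForm ℝ (Vec d) :=
    LinearMap.mk₂ ℝ (fun θ θ' => ∑ k, inner ℝ θ (x k) * inner ℝ θ' (x k) - n * energyForm hQ θ θ')
      (fun a b c => by
        simp only [inner_add_left, add_mul, Finset.sum_add_distrib, map_add, LinearMap.add_apply]
        ring)
      (fun r a b => by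
        simp only [inner_smul_left, mul_assoc, ← Finset.mul_sum, map_smul, LinearMap.smul_apply,
          smul_eq_mul, RCLike.conj_to_real]
        ring)
      (fun a b c => by
        simp only [inner_add_left, mul_add, Finset.sum_add_distrib, map_add]
        ring)
      (fun r a b => by
        simp only [inner_smul_left, mul_left_comm _ r, ← Finset.mul_sum, map_smul,
          smul_eq_mul, RCLike.conj_to_real]
        ring)
  have hD : ∀ θ θ', D θ θ' =
      ∑ k, inner ℝ θ (x k) * inner ℝ θ' (x k) - n * energyForm hQ θ θ' := fun _ _ => rfl
  have hDself : ∀ θ, D θ θ = ∑ k, (inner ℝ θ (x k)) ^ 2 - n * ∫ y, (inner ℝ θ y) ^ 2 ∂Q :=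
    fun θ => by simp only [hD, energyForm_self, sq]
  have hDcomm : ∀ θ θ', D θ θ' = D θ' θ := fun θ θ' => by
    simp only [hD, energyForm_comm hQ θ θ', mul_comm]
  have hEsum : ∫ y, (inner ℝ (∑ i, c i • u i) y) ^ 2 ∂Q = ∑ i, c i ^ 2 := by
    rw [← energyForm_self hQ]
    simp [map_sum, LinearMap.sum_apply, hu, sq]
  have hr : ∀ i j, |D (u i) (u j)| ≤ s * n := fun i j => by
    have h1 := hx i j (u i + u j) (by simp)
    have h2 := hx i j (u i - u j) (by simp)
    rw [← hDself, ← energyForm_self hQ] at h1 h2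
    -- Polarization recovers D(uᵢ, uⱼ) from uᵢ ± uⱼ. The energies of these two directions sum to 4
    -- by the parallelogram identity, also when i = j, hence the entrywise bound s n.
    have hpol : 4 * D (u i) (u j) = D (u i + u j) (u i + u j) - D (u i - u j) (u i - u j) := by
      simp only [map_add, map_sub, LinearMap.add_apply, LinearMap.sub_apply, hDcomm (u j) (u i)]
      ring
    have hpar : energyForm hQ (u i + u j) (u i + u j) + energyForm hQ (u i - u j) (u i - u j) =
        4 := by
      simp only [map_add, map_sub, LinearMap.add_apply, LinearMap.sub_apply, hu, if_true]
      ring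
    have h3 : s * (n * energyForm hQ (u i + u j) (u i + u j)) +
        s * (n * energyForm hQ (u i - u j) (u i - u j)) = 4 * (s * n) := by
      rw [← mul_add, ← mul_add, hpar]; ring
    rw [abs_le] at h1 h2 ⊢
    constructor <;> linarith [h1.1, h1.2, h2.1, h2.2]
  have := abs_bilinForm_sum_le D u hr c
  rw [hDself] at this
  refine this.trans (le_of_eq ?_)
  rw [hEsum]; ring

/-- Two ways to keep part of the threshold: 8.4 · 26.3² > 5000 serves the binomial tails, and the
factor (1.4 d)² offsets the d² lost in the union bound at level 8 / (9d). -/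
theorem gaussianThreshold_spec {ε : ℝ} (hε : ε ∈ Set.Ioo (0 : ℝ) (1 / 2)) :
    5000 * Real.log ε⁻¹ ≤ gaussianThreshold d ε ∧
      8.4 * (0.73 * d + Real.log ε⁻¹) * (1.4 * d) ^ 2 ≤ gaussianThreshold d ε := by
  have hL : 0 < Real.log ε⁻¹ := Real.log_pos ((one_lt_inv₀ hε.1).2 (by linarith [hε.2]))
  have hd : (0 : ℝ) ≤ d := Nat.cast_nonneg d
  unfold gaussianThreshold
  constructor
  · have h1 : (26.3 : ℝ) ^ 2 ≤ (1.4 * d + 4 * Real.log ε⁻¹ + 26.3) ^ 2 :=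
      pow_le_pow_left₀ (by norm_num) (by linarith) 2
    have h2 : 8.4 * Real.log ε⁻¹ ≤ 8.4 * (0.73 * d + Real.log ε⁻¹) := by linarith
    have := mul_le_mul h2 h1 (by positivity) (by positivity)
    linarith
  · exact mul_le_mul_of_nonneg_left (pow_le_pow_left₀ (by positivity) (by linarith) 2)
      (by positivity)

/-- The union bound has 2d² directions, each with probability at most twice the exponential. The
constants are such that 8.4 · 1.4² · 0.124 · (8/9)² ≥ 1.61. -/
theorem four_mul_sq_mul_exp_le {ε : ℝ} (hε : ε ∈ Set.Ioo (0 : ℝ) (1 / 2)) (hd : 0 < d) {n : ℕ}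
    (hn : gaussianThreshold d ε ≤ n) :
    4 * (d : ℝ) ^ 2 * Real.exp (-(n * (0.124 * (8 / (9 * d)) ^ 2))) ≤ 2 * ε := by
  have hL : 0 < Real.log ε⁻¹ := Real.log_pos ((one_lt_inv₀ hε.1).2 (by linarith [hε.2]))
  have hd1 : (1 : ℝ) ≤ d := by exact_mod_cast hd
  have hd0 : (0 : ℝ) < d := by linarith
  -- The tangent to log at 2. It bounds 2 log d by d plus a constant, which 1.61 · 0.73 d > 1.17 d
  -- absorbs for d ≥ 1.
  have hlogd : Real.log d ≤ d / 2 - 1 + Real.log 2 := by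
    have := Real.log_le_sub_one_of_pos (show (0 : ℝ) < d / 2 by linarith)
    rw [Real.log_div hd0.ne' (by norm_num)] at this
    linarith
  have hexp : Real.log ε⁻¹ + Real.log 2 + 2 * Real.log d ≤ n * (0.124 * (8 / (9 * d)) ^ 2) := by
    have h1 : 1.61 * (0.73 * d + Real.log ε⁻¹) ≤ n * (0.124 * (8 / (9 * d)) ^ 2) := by
      refine le_trans ?_ (mul_le_mul_of_nonneg_right ((gaussianThreshold_spec hε).2.trans hn)
        (by positivity))
      have : 8.4 * (0.73 * d + Real.log ε⁻¹) * (1.4 * d) ^ 2 * (0.124 * (8 / (9 * d)) ^ 2) =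
          8.4 * 1.96 * 0.124 * (64 / 81) * (0.73 * d + Real.log ε⁻¹) := by
        field_simp; ring
      rw [this]
      have : 0 < 0.73 * d + Real.log ε⁻¹ := by positivity
      nlinarith
    have := Real.log_two_lt_d9
    linarith
  have h2 : Real.exp (-(n * (0.124 * (8 / (9 * d)) ^ 2))) ≤ ε / (2 * d ^ 2) := by
    rw [← Real.le_log_iff_exp_le (by have := hε.1; positivity),
      Real.log_div hε.1.ne' (by positivity), Real.log_mul (by norm_num) (by positivity),
      Real.log_pow]
    rw [Real.log_inv] at hexp
    push_cast
    linarith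
  calc 4 * (d : ℝ) ^ 2 * Real.exp (-(n * (0.124 * (8 / (9 * d)) ^ 2)))
      ≤ 4 * (d : ℝ) ^ 2 * (ε / (2 * d ^ 2)) := by gcongr
    _ = 2 * ε := by field_simp; ring

/-- The relative deviations of the empirical Gram matrix of a Gaussian design. -/
theorem sampleHolds_gramDevLe_of_isGaussian [IsProbabilityMeasure Q] (hg : IsGaussian Q)
    (hQ : MemLp (fun x : Vec d => x) 2 Q) (hG : (gram Q).rank = d) (θs : Vec d) (σ : ℝ) {ε : ℝ}
    (hε : ε ∈ Set.Ioo (0 : ℝ) (1 / 2)) {n : ℕ} (hn : gaussianThreshold d ε ≤ n) :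
    SampleHolds (linearModel Q θs σ) n (1 - 2 * ε)
      (fun z => GramDevLe (linearModel Q θs σ) (8 / 9) z) := by
  set P := linearModel Q θs σ with hP
  have hL : 0 < Real.log ε⁻¹ := Real.log_pos ((one_lt_inv₀ hε.1).2 (by linarith [hε.2]))
  have hn0 : (0 : ℝ) < n := by linarith [(gaussianThreshold_spec (d := d) hε).1]
  rcases Nat.eq_zero_or_pos d with rfl | hd
  · refine SampleHolds.of_forall (by linarith [hε.1]) fun z θ => ?_
    rw [Subsingleton.elim θ 0]
    simp [RelDevLe, energy_zero, empEnergy]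
  have hd1 : (1 : ℝ) ≤ d := by exact_mod_cast hd
  have hd0 : (0 : ℝ) < d := by linarith
  obtain ⟨u, hu, hspan⟩ := exists_energyForm_orthonormal hQ hG
  set s : ℝ := 8 / (9 * d) with hs
  have hsI : s ∈ Set.Icc (0 : ℝ) (8 / 9) := by
    refine ⟨by positivity, ?_⟩
    rw [hs, div_le_div_iff₀ (by positivity) (by norm_num)]
    linarith
  let w : Fin d × Fin d × Bool → Vec d := fun k =>
    if k.2.2 then u k.1 + u k.2.1 else u k.1 - u k.2.1
  let bad : Vec d → Set (Fin n → Pair d) := fun θ =>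
    {z | s * (n * ∫ x, (inner ℝ θ x) ^ 2 ∂Q) <
        |∑ i, (inner ℝ θ (z i).1) ^ 2 - n * ∫ x, (inner ℝ θ x) ^ 2 ∂Q|}
  have hbadm : ∀ θ, MeasurableSet (bad θ) := fun θ =>
    measurableSet_lt measurable_const (by fun_prop)
  have hbadP : Measure.pi (fun _ : Fin n => P) (⋃ k, bad (w k)) ≤ ENNReal.ofReal (2 * ε) := by
    refine (measure_iUnion_fintype_le _ _).trans ((Finset.sum_le_sum fun k _ =>
      pi_linearModel_energy_deviation hg hQ hG θs σ (w k) n hsI).trans ?_)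
    rw [Finset.sum_const, Finset.card_univ]
    simp only [Fintype.card_prod, Fintype.card_fin, Fintype.card_bool, nsmul_eq_mul]
    refine le_trans (le_of_eq ?_) (ENNReal.ofReal_le_ofReal (four_mul_sq_mul_exp_le hε hd hn))
    rw [ENNReal.ofReal_mul (by positivity), ← hs, ← mul_assoc]
    congr 1
    rw [ENNReal.ofReal_mul (by norm_num), ENNReal.ofReal_pow hd0.le, ENNReal.ofReal_natCast]
    push_cast
    rw [show ENNReal.ofReal 4 = 2 * 2 by rw [show (4 : ℝ) = 2 * 2 by norm_num,
      ENNReal.ofReal_mul (by norm_num)]; simp]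
    ring
  refine ⟨(⋃ k, bad (w k))ᶜ, (MeasurableSet.iUnion fun k => hbadm _).compl, ?_, ?_⟩
  · rw [prob_compl_eq_one_sub (MeasurableSet.iUnion fun k => hbadm _),
      ENNReal.ofReal_sub _ (by linarith [hε.1]), ENNReal.ofReal_one]
    exact tsub_le_tsub_left hbadP 1
  · intro z hz θ
    have hz' : ∀ k, |∑ i, (inner ℝ (w k) (z i).1) ^ 2 - n * ∫ x, (inner ℝ (w k) x) ^ 2 ∂Q| ≤
        s * (n * ∫ x, (inner ℝ (w k) x) ^ 2 ∂Q) := fun k => by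
      by_contra hlt
      exact hz (Set.mem_iUnion.2 ⟨k, not_le.1 hlt⟩)
    obtain ⟨c, rfl⟩ := hspan θ
    have hdev := abs_sum_sq_sub_energy_le hQ hu (fun k => (z k).1) (s := s) (fun i j v hv => by
      rcases hv with rfl | rfl
      · exact hz' (i, j, true)
      · exact hz' (i, j, false)) c
    set θ := ∑ i, c i • u i
    have hsd : s * d = 8 / 9 := by rw [hs]; field_simp
    rw [hsd, ← energy_linearModel Q θs σ, ← hP] at hdev
    have he : ∑ i, (inner ℝ θ (z i).1) ^ 2 = n * empEnergy z θ := by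
      rw [empEnergy]; field_simp
    rw [he, ← mul_sub, abs_mul, abs_of_pos hn0, mul_left_comm] at hdev
    have hdev' := le_of_mul_le_mul_left hdev hn0
    unfold RelDevLe
    split_ifs with hE
    · rw [hE] at hdev'
      simpa using hdev'
    · have hE' : 0 < energy P θ := lt_of_le_of_ne (energy_nonneg P θ) (Ne.symm hE)
      rw [div_sub_one hE, abs_div, abs_of_pos hE', div_le_iff₀ hE']
      exact hdev'

/-- The design kurtosis of a Gaussian vector. -/
theorem kappa1_of_isGaussian [IsProbabilityMeasure Q] (hg : IsGaussian Q)
    (hQ : MemLp (fun x : Vec d => x) 2 Q) (hG : (gram Q).rank = d) (θs : Vec d) (σ : ℝ)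
    (hd : 2 ≤ d ∨ (d = 1 ∧ ∫ x, x ∂Q = 0)) : kappa1 (linearModel Q θs σ) = 3 := by
  have h2 : ∀ (θ : Vec d) (v : ℝ≥0),
      Q.map (fun x => inner ℝ θ x) = gaussianReal (inner ℝ θ (∫ x, x ∂Q)) v →
      ∫⁻ z, ENNReal.ofReal ((inner ℝ θ z.1) ^ 2) ∂(linearModel Q θs σ) =
        ENNReal.ofReal ((inner ℝ θ (∫ x, x ∂Q)) ^ 2 + v) := fun θ v h => by
    rw [lintegral_linearModel_fst Q θs σ (f := fun x => ENNReal.ofReal ((inner ℝ θ x) ^ 2))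
      (by fun_prop), ← lintegral_sq_gaussianReal, ← h, lintegral_map (by fun_prop) (by fun_prop)]
  have h4 : ∀ (θ : Vec d) (v : ℝ≥0),
      Q.map (fun x => inner ℝ θ x) = gaussianReal (inner ℝ θ (∫ x, x ∂Q)) v →
      ∫⁻ z, ENNReal.ofReal ((inner ℝ θ z.1) ^ 4) ∂(linearModel Q θs σ) =
        ENNReal.ofReal ((inner ℝ θ (∫ x, x ∂Q)) ^ 4 + 6 * (inner ℝ θ (∫ x, x ∂Q)) ^ 2 * v +
          3 * (v : ℝ) ^ 2) := fun θ v h => by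
    rw [lintegral_linearModel_fst Q θs σ (f := fun x => ENNReal.ofReal ((inner ℝ θ x) ^ 4))
      (by fun_prop), ← lintegral_pow_four_gaussianReal, ← h,
      lintegral_map (by fun_prop) (by fun_prop)]
  apply le_antisymm
  · refine iSup₂_le fun θ hθ => ?_
    obtain ⟨v, hlaw, -⟩ := exists_map_inner_eq_gaussianReal hg θ
    rw [h2 θ v hlaw, ENNReal.ofReal_le_one] at hθ
    rw [h4 θ v hlaw, show (3 : ℝ≥0∞) = ENNReal.ofReal 3 by simp]
    refine ENNReal.ofReal_le_ofReal ?_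
    set m : ℝ := inner ℝ θ (∫ x, x ∂Q)
    have h0 : 0 ≤ m ^ 2 + v := by positivity
    -- 3(m² + v)² exceeds the fourth moment m⁴ + 6m²v + 3v² by 2m⁴.
    nlinarith [sq_nonneg (m ^ 2), mul_le_mul hθ hθ h0 zero_le_one]
  -- Equality requires a nonzero direction in which the design is centred, that is, one orthogonal
  -- to the mean. It exists for d ≥ 2, or for d = 1 with zero mean.
  · obtain ⟨θ, hθ, hm⟩ : ∃ θ : Vec d, θ ≠ 0 ∧ inner ℝ θ (∫ x, x ∂Q) = (0 : ℝ) := by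
      rcases hd with hd | ⟨hd, h0⟩
      · have hfr : Module.finrank ℝ (Vec d) = d := by simp
        have hlt : Module.finrank ℝ (ℝ ∙ (∫ x, x ∂Q)) < Module.finrank ℝ (Vec d) := by
          have := finrank_span_le_card (R := ℝ) ({∫ x, x ∂Q} : Set (Vec d))
          simp only [Set.toFinset_singleton, Finset.card_singleton] at this
          omega
        have hne : (ℝ ∙ (∫ x, x ∂Q))ᗮ ≠ ⊥ := fun h => by
          rw [Submodule.orthogonal_eq_bot_iff] at h
          rw [h, finrank_top] at hlt
          exact lt_irrefl _ hlt
        obtain ⟨θ, hθ, h0⟩ := Submodule.exists_mem_ne_zero_of_ne_bot hne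
        exact ⟨θ, h0, by
          rw [real_inner_comm]; exact Submodule.mem_orthogonal_singleton_iff_inner_right.1 hθ⟩
      · subst hd
        exact ⟨EuclideanSpace.single 0 1, by simp, by rw [h0, inner_zero_right]⟩
    set E := ∫ x, (inner ℝ θ x) ^ 2 ∂Q with hE
    have hEpos : 0 < E := energy_pos_of_rank_gram hQ hG hθ
    set θ' := (√E)⁻¹ • θ with hθ'
    have hE' : ∫ x, (inner ℝ θ' x) ^ 2 ∂Q = 1 := by
      have : ∀ x : Vec d, (inner ℝ θ' x) ^ 2 = E⁻¹ * (inner ℝ θ x) ^ 2 := fun x => by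
        rw [hθ', inner_smul_left, mul_pow]
        congr 1
        simp [Real.sq_sqrt hEpos.le]
      simp_rw [this]
      rw [integral_const_mul, ← hE, inv_mul_cancel₀ hEpos.ne']
    have hm' : inner ℝ θ' (∫ x, x ∂Q) = (0 : ℝ) := by
      rw [hθ', inner_smul_left, hm, mul_zero]
    obtain ⟨v, hlaw, hv⟩ := exists_map_inner_eq_gaussianReal hg θ'
    have hv1 : (v : ℝ) = 1 := by rw [hE', hm'] at hv; linarith
    refine le_iSup₂_of_le θ' ?_ ?_
    · rw [h2 θ' v hlaw, hm', hv1]; simp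
    · rw [h4 θ' v hlaw, hm', hv1]; simp

end GaussianDesign

/-! ### The main theorem -/

/-- (7/4)² > e. For K = 7/4 it gives K log K - K + 1 ≥ 1/8. -/
theorem half_le_log_seven_div_four : 1 / 2 ≤ Real.log (7 / 4) := by
  rw [Real.le_log_iff_exp_le (by norm_num)]
  have h : Real.exp (1 / 2) ^ 2 = Real.exp 1 := by
    rw [← Real.exp_nat_mul]; norm_num
  have := Real.exp_one_lt_d9
  nlinarith [Real.exp_pos (1 / 2)]

/-- (3/2)⁵ > e². For K = 3/2 it gives K log K - K + 1 ≥ 1/10. -/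
theorem two_fifths_le_log_three_div_two : 2 / 5 ≤ Real.log (3 / 2) := by
  rw [Real.le_log_iff_exp_le (by norm_num)]
  refine le_of_pow_le_pow_left₀ (n := 5) (by norm_num) (by norm_num) ?_
  have h : Real.exp (2 / 5) ^ 5 = Real.exp 1 ^ 2 := by
    rw [← Real.exp_nat_mul, ← Real.exp_nat_mul]; norm_num
  rw [h]
  have h2 := pow_le_pow_left₀ (Real.exp_pos 1).le Real.exp_one_lt_d9.le 2
  refine h2.trans (by norm_num)

section MainTheorem

variable {d : ℕ} {Q : Measure (Vec d)} [IsProbabilityMeasure Q] (θs : Vec d) {σ : ℝ}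

theorem kappa_sum_censored (hσ : 0 < σ) {p : unitInterval} (hp : 0 < p) :
    kappa1 (censored (linearModel Q θs σ) p) = kappa1 (linearModel Q θs σ) / ENNReal.ofReal p ∧
      kappa2 (censored (linearModel Q θs σ) p) θs =
        kappa2 (linearModel Q θs σ) θs / ENNReal.ofReal p := by
  refine ⟨kappa1_censored _ p hp, kappa2_censored _ p hp θs ?_⟩
  rw [lintegral_linearModel_residual Q θs σ (f := fun y => ENNReal.ofReal (y ^ 2)) (by fun_prop),
    lintegral_sq_gaussianReal, ENNReal.ofReal_pos, Real.coe_toNNReal _ (sq_nonneg σ)]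
  positivity

theorem kappaSum_censored (hσ : 0 < σ) {p : unitInterval} (hp : 0 < p) :
    kappaSum (censored (linearModel Q θs σ) p) θs = kappaSum (linearModel Q θs σ) θs / p := by
  obtain ⟨h1, h2⟩ := kappa_sum_censored (Q := Q) θs hσ hp
  rw [kappaSum, h1, h2, ← ENNReal.add_div, ENNReal.toReal_div, ENNReal.toReal_ofReal p.2.1,
    kappaSum]

theorem kappaSum_linearModel_pos (hσ : 0 < σ) (hκ : kappa1 (linearModel Q θs σ) ≠ ∞) :
    0 < kappaSum (linearModel Q θs σ) θs := by
  rw [kappaSum, kappa2_linearModel Q θs hσ]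
  exact ENNReal.toReal_pos (by simp) (by simp [hκ])

theorem risk_min (hQ : MemLp (fun x : Vec d => x) 2 Q) (θ : Vec d) :
    risk (linearModel Q θs σ) θs ≤ risk (linearModel Q θs σ) θ := by
  rw [risk_linearModel θs σ hQ, risk_linearModel θs σ hQ, sub_self, energy_zero]
  linarith [energy_nonneg (linearModel Q θs σ) (θ - θs)]

theorem risk_censored_linearModel (hQ : MemLp (fun x : Vec d => x) 2 Q) (p : unitInterval)
    (θ : Vec d) : risk (censored (linearModel Q θs σ) p) θ = p * risk (linearModel Q θs σ) θ :=
  risk_censored _ p θ (integrable_residual_sq θs σ hQ θ)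

theorem risk_censored_min (hQ : MemLp (fun x : Vec d => x) 2 Q) (p : unitInterval) (θ : Vec d) :
    risk (censored (linearModel Q θs σ) p) θs ≤ risk (censored (linearModel Q θs σ) p) θ := by
  rw [risk_censored_linearModel θs hQ, risk_censored_linearModel θs hQ]
  exact mul_le_mul_of_nonneg_left (risk_min θs hQ θ) p.2.1

theorem risk_censored_self (hQ : MemLp (fun x : Vec d => x) 2 Q) (p : unitInterval) :
    risk (censored (linearModel Q θs σ) p) θs = p * σ ^ 2 := by
  rw [risk_censored_linearModel θs hQ, risk_linearModel θs σ hQ, sub_self, energy_zero, add_zero]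

theorem exists_censoring_kappa_ge (hσ : 0 < σ) (M : ℝ≥0) : ∃ p : unitInterval, 0 < p ∧
    (M : ℝ≥0∞) ≤ kappa1 (censored (linearModel Q θs σ) p) +
      kappa2 (censored (linearModel Q θs σ) p) θs := by
  have hM : (0 : ℝ) < (1 + M : ℝ)⁻¹ := by positivity
  have hM1 : (1 + M : ℝ)⁻¹ ≤ 1 := inv_le_one_of_one_le₀ (by linarith [M.2])
  -- With this p the noise kurtosis alone, 3(1 + M), already exceeds M.
  let p : unitInterval := ⟨(1 + M : ℝ)⁻¹, hM.le, hM1⟩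
  have hp : 0 < p := hM
  refine ⟨p, hp, le_add_left ?_⟩
  rw [(kappa_sum_censored (Q := Q) θs hσ hp).2, kappa2_linearModel Q θs hσ]
  have hpe : ENNReal.ofReal p = (1 + M : ℝ≥0∞)⁻¹ := by
    change ENNReal.ofReal (1 + M : ℝ)⁻¹ = _
    rw [ENNReal.ofReal_inv_of_pos (by positivity)]
    congr 1
    have := ENNReal.ofReal_add zero_le_one M.coe_nonneg
    rwa [ENNReal.ofReal_one, ENNReal.ofReal_coe_nnreal] at this
  rw [hpe, div_eq_mul_inv, inv_inv]
  calc (M : ℝ≥0∞) ≤ 1 + M := le_add_self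
    _ = 1 * (1 + M) := (one_mul _).symm
    _ ≤ 3 * (1 + M) := by gcongr; norm_num

/-- The lower bound for censored samples, in terms of the kurtosis coefficients. -/
theorem excess_risk_lower_bound_kappa (hQ : MemLp (fun x : Vec d => x) 2 Q)
    (hG : (gram Q).rank = d) (hσ : 0 < σ) {ε δ : ℝ} (hε : ε ∈ Set.Ioo (0 : ℝ) (1 / 2))
    (hδ : δ ∈ Set.Ioo (0 : ℝ) 1) {nε : ℕ}
    (h : ∀ n : ℕ, 0 < n → nε ≤ n → SampleHolds (linearModel Q θs σ) n (1 - 2 * ε)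
      (fun z => GramDevLe (linearModel Q θs σ) δ z))
    (hκ : kappa1 (linearModel Q θs σ) ≠ ∞) {p : unitInterval} (hp : 0 < p) {n : ℕ}
    (hn : 4 * kappaSum (censored (linearModel Q θs σ) p) θs *
      max (nε : ℝ) (2 * Real.log ε⁻¹) / kappaSum (linearModel Q θs σ) θs ≤ n) :
    SampleHolds (censored (linearModel Q θs σ) p) n (1 - 5 * ε) (fun z => ∀ θ, IsERM z θ →
      4 * (d * Real.log 2 - 2 * Real.log ε⁻¹) * kappaSum (censored (linearModel Q θs σ) p) θs
          / (7 * (1 + δ) * kappaSum (linearModel Q θs σ) θs * n) *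
          risk (censored (linearModel Q θs σ) p) θs
        ≤ risk (censored (linearModel Q θs σ) p) θ -
          risk (censored (linearModel Q θs σ) p) θs) := by
  have hp' : (0 : ℝ) < p := hp
  have hL : 0 < Real.log ε⁻¹ := Real.log_pos ((one_lt_inv₀ hε.1).2 (by linarith [hε.2]))
  have hκpos := kappaSum_linearModel_pos θs hσ hκ
  rw [kappaSum_censored θs hσ hp] at hn ⊢
  rw [risk_censored_self θs hQ]
  set κ := kappaSum (linearModel Q θs σ) θs
  have hn' : 4 * max (nε : ℝ) (2 * Real.log ε⁻¹) ≤ n * p := by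
    rw [← div_le_iff₀ hp']
    refine le_trans (le_of_eq ?_) hn
    field_simp
  have hm1 := le_max_left (nε : ℝ) (2 * Real.log ε⁻¹)
  have hm2 := le_max_right (nε : ℝ) (2 * Real.log ε⁻¹)
  have hlog := half_le_log_seven_div_four
  -- K = 7/4 yields the factor 4/7, and its rate 1/8 matches np ≥ 8 log ε⁻¹, the condition already
  -- needed for the lower binomial tail.
  have hb := excess_risk_lower_bound_censored hQ hG θs (K := 7 / 4) (n := n) hσ hε hδ p
    (by norm_num) (by linarith) (by nlinarith) fun m hm => by
      have h1 : (0 : ℝ) < m := by linarith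
      have h2 : (nε : ℝ) ≤ m := by linarith
      exact h m (by exact_mod_cast h1) (by exact_mod_cast h2)
  refine hb.mono le_rfl fun z hz θ hθ => ?_
  refine le_trans (le_of_eq ?_) (by simpa only [risk_censored_self θs hQ] using hz θ hθ)
  have hn0 : (0 : ℝ) < n := by
    by_contra hc
    nlinarith
  have hδ1 : 0 < 1 + δ := by linarith [hδ.1]
  field_simp

/-- The lower bound for censored samples of a Gaussian design. -/
theorem excess_risk_lower_bound_of_isGaussian (hg : IsGaussian Q)
    (hQ : MemLp (fun x : Vec d => x) 2 Q) (hG : (gram Q).rank = d) (hσ : 0 < σ) {ε : ℝ}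
    (hε : ε ∈ Set.Ioo (0 : ℝ) (1 / 2)) {p : unitInterval} (hp : 0 < p) {n : ℕ}
    (hn : 2 / 3 * kappaSum (censored (linearModel Q θs σ) p) θs * gaussianThreshold d ε ≤ n) :
    SampleHolds (censored (linearModel Q θs σ) p) n (1 - 5 * ε) (fun z => ∀ θ, IsERM z θ →
      35 / 1000 * ((d - 3 * Real.log ε⁻¹) * kappaSum (censored (linearModel Q θs σ) p) θs / n)
          * risk (censored (linearModel Q θs σ) p) θs
        ≤ risk (censored (linearModel Q θs σ) p) θ -
          risk (censored (linearModel Q θs σ) p) θs) := by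
  have hp' : (0 : ℝ) < p := hp
  have hlog2 := Real.log_two_gt_d9
  have hLlog2 : Real.log 2 ≤ Real.log ε⁻¹ :=
    Real.log_le_log (by norm_num) ((le_inv_comm₀ (by norm_num) hε.1).2 (by linarith [hε.2]))
  have hL : 0 < Real.log ε⁻¹ := by linarith
  -- If d ≤ 3 log ε⁻¹ the claimed bound is nonpositive. Otherwise d > 3 log 2 > 2, so the kurtosis
  -- sum is 6 even for a noncentred design.
  rcases le_or_gt ((d : ℝ) - 3 * Real.log ε⁻¹) 0 with hd | hd
  · refine SampleHolds.of_forall (by linarith [hε.1]) fun z θ _ => ?_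
    have h1 := risk_censored_min θs (σ := σ) hQ p θ
    have h2 : 0 ≤ risk (censored (linearModel Q θs σ) p) θs :=
      integral_nonneg fun _ => sq_nonneg _
    have h3 : 0 ≤ kappaSum (censored (linearModel Q θs σ) p) θs := ENNReal.toReal_nonneg
    have h4 : (d - 3 * Real.log ε⁻¹) * kappaSum (censored (linearModel Q θs σ) p) θs / n ≤ 0 :=
      div_nonpos_of_nonpos_of_nonneg (mul_nonpos_of_nonpos_of_nonneg hd h3) (Nat.cast_nonneg n)
    have h5 := mul_nonpos_of_nonpos_of_nonneg
      (mul_nonpos_of_nonneg_of_nonpos (by norm_num : (0 : ℝ) ≤ 35 / 1000) h4) h2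
    linarith
  have hd2 : 2 ≤ d := by
    have : (2 : ℝ) < d := by linarith
    exact_mod_cast this.le
  have hκ : kappaSum (linearModel Q θs σ) θs = 6 := by
    rw [kappaSum, kappa1_of_isGaussian hg hQ hG θs σ (Or.inl hd2), kappa2_linearModel Q θs hσ]
    norm_num
  rw [kappaSum_censored θs hσ hp, hκ] at hn ⊢
  have hT := (gaussianThreshold_spec (d := d) hε).1
  have hn' : 4 * gaussianThreshold d ε ≤ n * p := by
    rw [← div_le_iff₀ hp']
    refine le_trans (le_of_eq ?_) hn
    field_simp; ring
  have hlog := two_fifths_le_log_three_div_two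
  -- Here np is at least 20000 log ε⁻¹, so the smaller K = 3/2, with rate 1/10, is affordable.
  have hb := excess_risk_lower_bound_censored hQ hG θs (K := 3 / 2) (n := n) (δ := 8 / 9) hσ hε
    (by norm_num) p (by norm_num) (by linarith) (by nlinarith) fun m hm =>
      sampleHolds_gramDevLe_of_isGaussian hg hQ hG θs σ hε (by linarith)
  refine hb.mono le_rfl fun z hz θ hθ => le_trans ?_ (hz θ hθ)
  rw [risk_censored_self θs hQ]
  have hn0 : (0 : ℝ) < n := by
    by_contra hc
    nlinarith
  have hL2 : (d - 3 * Real.log ε⁻¹) * 0.69 ≤ d * Real.log 2 - 2 * Real.log ε⁻¹ := by nlinarith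
  have h1 : 35 / 1000 * ((d - 3 * Real.log ε⁻¹) * (6 / p) / n) * (p * σ ^ 2) =
      0.21 * (d - 3 * Real.log ε⁻¹) * (σ ^ 2 / n) := by
    field_simp; ring
  have h2 : (d * Real.log 2 - 2 * Real.log ε⁻¹) * σ ^ 2 / ((1 + 8 / 9) * (3 / 2) * n) =
      6 / 17 * (d * Real.log 2 - 2 * Real.log ε⁻¹) * (σ ^ 2 / n) := by
    field_simp; ring
  rw [h1, h2]
  -- Numerically, 0.69 · 6/17 > 0.24 exceeds 0.21 = 6 · 35/1000.
  exact mul_le_mul_of_nonneg_right (by linarith) (by positivity)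

end MainTheorem

theorem proposition4p9 (d : ℕ)
    -- the law of the design vector, with a Gram matrix that exists and has full rank
    (Q : Measure (Vec d)) [IsProbabilityMeasure Q]
    (hQ : MemLp (fun x : Vec d => x) 2 Q) (hG : (gram Q).rank = d)
    (θs : Vec d) (σ : ℝ) (hσ : 0 < σ) (ε : ℝ) (hε : ε ∈ Set.Ioo (0 : ℝ) (1 / 2))
    -- the law of the uncensored couple
    (P : Measure (Pair d)) (hP : P = linearModel Q θs σ) :
    -- `θs` minimizes both risks
    (∀ θ, risk P θs ≤ risk P θ) ∧
    (∀ p : unitInterval, 0 < p → ∀ θ, risk (censored P p) θs ≤ risk (censored P p) θ) ∧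
    -- the kurtosis coefficients before and after censoring
    kappa2 P θs = 3 ∧
    (∀ p : unitInterval, 0 < p →
      kappa1 (censored P p) = kappa1 P / ENNReal.ofReal p ∧
      kappa2 (censored P p) θs = kappa2 P θs / ENNReal.ofReal p ∧
      (kappa1 P ≠ ∞ → (p : ℝ)⁻¹ = kappaSum (censored P p) θs / kappaSum P θs)) ∧
    -- `κ₁ + κ₂` becomes arbitrarily large as the censoring parameter varies
    (∀ M : ℝ≥0, ∃ p : unitInterval, 0 < p ∧
      (M : ℝ≥0∞) ≤ kappa1 (censored P p) + kappa2 (censored P p) θs) ∧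
    -- the lower bounds under a uniform bound on the deviations of the empirical Gram matrix
    (∀ (δ : ℝ) (nε : ℕ), δ ∈ Set.Ioo (0 : ℝ) 1 →
      (∀ n : ℕ, 0 < n → nε ≤ n → SampleHolds P n (1 - 2 * ε) (fun z => GramDevLe P δ z)) →
      -- uncensored data
      (∀ n : ℕ, 0 < n → nε ≤ n →
        SampleHolds P n (1 - 3 * ε) (fun z => ∀ θ, IsERM z θ →
          (d * Real.log 2 - 2 * Real.log ε⁻¹) * σ ^ 2 / ((1 + δ) * n)
            ≤ risk P θ - risk P θs)) ∧
      -- censored data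
      (kappa1 P ≠ ∞ → ∀ p : unitInterval, 0 < p →
        (∀ n : ℕ,
          4 * kappaSum (censored P p) θs * max (nε : ℝ) (2 * Real.log ε⁻¹) / kappaSum P θs ≤ n →
          SampleHolds (censored P p) n (1 - 5 * ε) (fun z => ∀ θ, IsERM z θ →
            4 * (d * Real.log 2 - 2 * Real.log ε⁻¹) * kappaSum (censored P p) θs
                / (7 * (1 + δ) * kappaSum P θs * n) * risk (censored P p) θs
              ≤ risk (censored P p) θ - risk (censored P p) θs)) ∧
        -- the first order term of any upper bound is at least proportional to `κ₁ + κ₂`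
        (∀ (θhat : (n : ℕ) → (Fin n → Pair d) → Vec d) (ε' : ℝ) (U : ℕ → ℝ) (A : ℝ),
          (∀ n z, IsERM z (θhat n z)) → 0 ≤ ε' → 5 * ε + ε' < 1 →
          (∀ᶠ n : ℕ in atTop, SampleHolds (censored P p) n (1 - ε') (fun z =>
            risk (censored P p) (θhat n z) - risk (censored P p) θs
              ≤ U n * risk (censored P p) θs)) →
          Tendsto (fun n : ℕ => n * U n) atTop (𝓝 A) →
          4 * (d * Real.log 2 - 2 * Real.log ε⁻¹) * kappaSum (censored P p) θs
            / (7 * (1 + δ) * kappaSum P θs) ≤ A))) ∧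
    -- Gaussian design
    (IsGaussian Q →
      (2 ≤ d ∨ (d = 1 ∧ ∫ x, x ∂Q = 0) → kappa1 P + kappa2 P θs = 6) ∧
      (∀ n : ℕ, gaussianThreshold d ε ≤ n →
        SampleHolds P n (1 - 2 * ε) (fun z => GramDevLe P (8 / 9) z)) ∧
      (∀ p : unitInterval, 0 < p → ∀ n : ℕ,
        2 / 3 * kappaSum (censored P p) θs * gaussianThreshold d ε ≤ n →
        SampleHolds (censored P p) n (1 - 5 * ε) (fun z => ∀ θ, IsERM z θ →
          35 / 1000 * ((d - 3 * Real.log ε⁻¹) * kappaSum (censored P p) θs / n)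
              * risk (censored P p) θs
            ≤ risk (censored P p) θ - risk (censored P p) θs))) := by
  subst hP
  refine ⟨risk_min θs hQ, fun p _ => risk_censored_min θs hQ p, kappa2_linearModel Q θs hσ,
    fun p hp => ⟨(kappa_sum_censored θs hσ hp).1, (kappa_sum_censored θs hσ hp).2, fun hκ => ?_⟩,
    exists_censoring_kappa_ge θs hσ, fun δ nε hδ h => ⟨fun n hn hnε =>
      excess_risk_lower_bound hQ hG θs hσ hε.1 hδ hn (h n hn hnε), fun hκ p hp =>
      ⟨fun n hn => excess_risk_lower_bound_kappa θs hQ hG hσ hε hδ h hκ hp hn, ?_⟩⟩,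
    fun hg => ⟨fun hd => ?_, fun n hn => sampleHolds_gramDevLe_of_isGaussian hg hQ hG θs σ hε hn,
      fun p hp n hn => excess_risk_lower_bound_of_isGaussian θs hg hQ hG hσ hε hp hn⟩⟩
  · have hκpos := kappaSum_linearModel_pos θs hσ hκ
    rw [kappaSum_censored θs hσ hp]
    field_simp
  · intro θhat ε' U A hERM _ hεε' hU hA
    have hR : 0 < risk (censored (linearModel Q θs σ) p) θs := by
      rw [risk_censored_self θs hQ]
      have hp' : (0 : ℝ) < p := hp
      positivity
    refine ge_of_tendsto hA ?_
    have hlarge := (tendsto_natCast_atTop_atTop (R := ℝ)).eventually_ge_atTop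
      (4 * kappaSum (censored (linearModel Q θs σ) p) θs *
        max (nε : ℝ) (2 * Real.log ε⁻¹) / kappaSum (linearModel Q θs σ) θs)
    filter_upwards [hU, hlarge, eventually_gt_atTop 0] with n hUn hn hn0
    -- The probabilities of the lower and upper bounds sum to more than 1, so some sample satisfies
    -- both. This gives a deterministic inequality on n `U n`, which passes to the limit.
    obtain ⟨z, hz1, hz2⟩ := (excess_risk_lower_bound_kappa θs hQ hG hσ hε hδ h hκ hp hn).exists_and
      hUn (by linarith)
    have hn' : (0 : ℝ) < n := by exact_mod_cast hn0
    have hle := le_of_mul_le_mul_right ((hz1 _ (hERM n z)).trans hz2) hR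
    rw [← div_div, div_le_iff₀ hn'] at hle
    linarith
  · rw [kappa1_of_isGaussian hg hQ hG θs σ hd, kappa2_linearModel Q θs hσ]
    norm_num
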